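/- Let $a=A^2$, $[n]=\frac{a^n-a^{-n}}{a-a^{-1}}$ and $[n]!=[1][2]\cdots[n]$. Let $\mathcal B=\mathbb Z[A^{\pm1}][z]$ be the Kauffman bracket skein module of the solid torus (crossing $=A\cdot$(one smoothing)$+A^{-1}\cdot$(other smoothing), trivial circle $=-a-a^{-1}$), where $z^n$ is the class of $n$ parallel copies of the core, and let $\mathcal B^{ev}\subset\mathcal B$ be the submodule generated by the even powers of $z$. Let $t:\mathcal B\to\mathcal B$ be the map induced by a full right-handed twist of the solid torus, let $\langle\cdot,\cdot\rangle$ be the $\mathbb Z[A^{\pm1}]$-valued bilinear form on $\mathcal B$ obtained by cabling the zero-framed Hopf link and taking the Kauffman bracket in $S^3$ (normalized to be $1$ on the empty link), and put $\langle x\rangle=\langle x,1\rangle$. Let $\mu_i=(-1)^iA^{i^2+2i}$ (the eigenvalues of $t$), $\lambda_i=-a^{i+1}-a^{-i-1}$ and $R_n=\prod_{i=0}^{n-1}(z-\lambda_{2i})$. Let $\widehat{\mathcal B}=\varprojlim_n \mathbb Q(A)[z]/(R_n)$ be the algebra of formal series $\sum_{n\ge0}c_nR_n$ with $c_n\in\mathbb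 Q(A)$. There is exactly one element $\omega=\sum_n c_nR_n\in\widehat{\mathcal B}$ such that $\langle\omega,x\rangle=\langle t(x)\rangle$ for every $x\in\mathcal B^{ev}$, where $\langle\omega,x\rangle=\sum_n c_n\langle R_n,x\rangle$ is a finite sum. This $\omega$ is invertible in $\widehat{\mathcal B}$, and for every $p\in\mathbb Z$ the (unique) coefficients in the expansion $\omega^p=\sum_{n\ge0}c_{n,p}R_n$ are $$c_{n,p}=\frac1{(a-a^{-1})^{2n}}\sum_{k=0}^n\frac{(-1)^k\mu_{2k}^p\,[2k+1]}{[n+k+1]!\,[n-k]!}\qquad(n\ge0).$$ -/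

import Mathlib

open Polynomial
open scoped LaurentPolynomial

namespace KauffmanSkein

noncomputable section

/-! ### Ground ring -/

/-- The ground ring `ℤ[A^{±1}]`. -/
abbrev Ground : Type := ℤ[T;T⁻¹]

/-- The power `A ^ k`, `k ∈ ℤ`, of the variable. -/
def A (k : ℤ) : Ground := LaurentPolynomial.T k

/-- The power `a ^ k` of `a = A ^ 2`. -/
def a (k : ℤ) : Ground := A (2 * k)

/-- The value `-a - a⁻¹` of a trivial circle. -/
def circleValue : Ground := -a 1 - a (-1)

/-- The skein module `ℬ = ℤ[A^{±1}][z]` of the solid torus (thickened annulus);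
`z ^ n` is the class of `n` parallel copies of the core. -/
abbrev Skein : Type := Ground[X]

/-! ### Link diagrams in the annulus and their Kauffman bracket

All diagrams needed below are closures, in an annulus, of braid-like diagrams on `n` vertical
strands (numbered `0, …, n - 1`), whose strands may carry small curls. -/

/-- The elementary pieces of a diagram: `cross i` is the positive crossing of the
strands in positions `i` and `i + 1`; `curl i` is a small positive curl in the strand in
position `i`. -/
inductive Piece : Type
  | cross (i : ℕ) : Piece
  | curl (i : ℕ) : Piece

/-- A crossingless diagram on `n` strands is a word `E` in the turn-backs
(`E[k] = i` means that at height `k` the strands `i` and `i + 1` are replaced by a cap and a cup).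
`(k, j)` is the point in position `j` between the heights `k - 1` and `k`.
`Joined n E` says that two such points are joined by one elementary arc of the annular
closure of the diagram. -/
inductive Joined (n : ℕ) (E : List ℕ) :
    Fin (E.length + 1) × Fin n → Fin (E.length + 1) × Fin n → Prop
  | through (k : Fin E.length) (j : Fin n) (h : (j : ℕ) ≠ E[k]) (h' : (j : ℕ) ≠ E[k] + 1) :
      Joined n E (k.castSucc, j) (k.succ, j)
  | cap (k : Fin E.length) (i j : Fin n) (hi : (i : ℕ) = E[k]) (hj : (j : ℕ) = E[k] + 1) :
      Joined n E (k.castSucc, i) (k.castSucc, j)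
  | cup (k : Fin E.length) (i j : Fin n) (hi : (i : ℕ) = E[k]) (hj : (j : ℕ) = E[k] + 1) :
      Joined n E (k.succ, i) (k.succ, j)
  | close (j : Fin n) : Joined n E (Fin.last E.length, j) (0, j)

/-- The circles of the annular closure of a crossingless diagram: the connected components of its
set of arcs. -/
def Circle (n : ℕ) (E : List ℕ) : Type := Quot (Joined n E)

/-- A circle is essential in the annulus (parallel to the core) if and only if it meets the radial
seam, which contains the points `(0, j)`, in an odd number of points; otherwise it
bounds a disk. -/
def Circle.Essential {n : ℕ} {E : List ℕ} (c : Circle n E) : Prop :=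
  Odd (Nat.card {j : Fin n // Quot.mk (Joined n E) (0, j) = c})

/-- The class in `ℬ` of the annular closure of a crossingless diagram. -/
def flatClass (n : ℕ) (E : List ℕ) : Skein :=
  C circleValue ^ Nat.card {c : Circle n E // ¬ c.Essential} *
    X ^ Nat.card {c : Circle n E // c.Essential}

/-- Resolution of the crossings of a diagram, one after the other, by the Kauffman relation
`crossing = A · (one smoothing) + A⁻¹ · (other smoothing)`; `E` is the crossingless part
obtained so far. The smoothings of `cross i` are two vertical strands and the turn-back at `i`;
those of a curl are the straight strand with a trivial circle beside it and the straight strand. -/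
def resolve (n : ℕ) : List Piece → List ℕ → Skein
  | [], E => flatClass n E
  | Piece.cross i :: D, E => A 1 • resolve n D E + A (-1) • resolve n D (E ++ [i])
  | Piece.curl _ :: D, E => A 1 • circleValue • resolve n D E + A (-1) • resolve n D E

/-- The class in `ℬ` of the annular closure of a diagram on `n` strands
(with blackboard framing). -/
def annularClass (n : ℕ) (D : List Piece) : Skein := resolve n D []

/-- The Kauffman bracket, in `S³`, of the closure of a diagram on `n` strands: the annulus
lies in the plane, where every circle has the value `-a - a⁻¹`. -/
def bracket (n : ℕ) (D : List Piece) : Ground := (annularClass n D).eval circleValue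

/-! ### The twist map and the Hopf pairing -/

/-- The crossings `i, i + 1, …, i + n - 1`: the strand in position `i` passes across the next `n`
strands to its right. -/
def passRight (i n : ℕ) : List Piece := (List.range n).map fun j => Piece.cross (i + j)

/-- The block of the first `m` strands passes across the block of the next `n` strands. -/
def blockCross (m n : ℕ) : List Piece :=
  ((List.range m).reverse.map fun i => passRight i n).flatten

/-- The braid whose closure is the zero-framed Hopf link with one component replaced by `m` and the
other by `n` parallel copies. -/
def hopfCable (m n : ℕ) : List Piece := blockCross m n ++ blockCross n m

/-- The last of `n + 1` strands runs once around the first `n` strands. -/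
def runAround (n : ℕ) : List Piece :=
  ((List.range n).reverse.map Piece.cross) ++ (List.range n).map Piece.cross

/-- The positive full twist braid on `n` strands. -/
def fullTwist : ℕ → List Piece
  | 0 => []
  | n + 1 => fullTwist n ++ runAround n

/-- The image of `n` parallel copies of the core under a full right-handed twist of the solid
torus: the bands undergo a full twist as a whole, hence each of them also gets a full twist, which
is drawn as a curl. -/
def twistedCable (n : ℕ) : List Piece := fullTwist n ++ (List.range n).map Piece.curl

/-- The twist map `t : ℬ → ℬ` induced by a full right-handed twist of the solid torus. -/
def twist (x : Skein) : Skein := x.sum fun n c => c • annularClass n (twistedCable n)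

/-- The bilinear form `⟨x, y⟩` on `ℬ` given by cabling the zero-framed Hopf link with `x`
and `y` and taking the bracket. -/
def pairing (x y : Skein) : Ground :=
  x.sum fun m c => y.sum fun n d => c * d * bracket (m + n) (hopfCable m n)

/-- `⟨x⟩ = ⟨x, 1⟩`. -/
def value (x : Skein) : Ground := pairing x 1

/-- The even part of `ℬ`. -/
def evenPart : Submodule Ground Skein :=
  Submodule.span Ground (Set.range fun k : ℕ => (X : Skein) ^ (2 * k))

/-- `λ_i = -a^{i+1} - a^{-i-1}`. -/
def lam (i : ℕ) : Ground := -a (i + 1) - a (-(i + 1))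

/-- `R_n = ∏_{i < n} (z - λ_{2i})`. -/
def R (n : ℕ) : Skein := ∏ i ∈ Finset.range n, (X - C (lam (2 * i)))

/-! ### The completed algebra containing `ω` -/

/-- The field `ℚ(A)`. -/
abbrev K : Type := FractionRing Ground

/-- `R_n` with coefficients in `ℚ(A)`. -/
def RK (n : ℕ) : K[X] := (R n).map (algebraMap Ground K)

theorem span_RK_succ_le (n : ℕ) :
    Ideal.span {RK (n + 1)} ≤ Ideal.span {RK n} := by
  rw [Ideal.span_singleton_le_span_singleton]
  simp only [RK, R, Finset.prod_range_succ, Polynomial.map_mul]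
  exact dvd_mul_right _ _

/-- The algebra of formal sums `∑ c_n R_n` with `c_n ∈ ℚ(A)`, that is, the inverse limit of the
algebras `ℚ(A)[z] / (R_n)` (recall that `R_n` divides `R_{n+1}`). -/
def Completed : Subring (∀ n : ℕ, K[X] ⧸ Ideal.span {RK n}) where
  carrier := {f | ∀ n, Ideal.Quotient.factor (span_RK_succ_le n) (f (n + 1)) = f n}
  mul_mem' := by
    intro f g hf hg n
    simp only [Pi.mul_apply, map_mul, hf n, hg n]
  one_mem' := by
    intro n
    simp only [Pi.one_apply, map_one]
  add_mem' := by
    intro f g hf hg n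
    simp only [Pi.add_apply, map_add, hf n, hg n]
  zero_mem' := by
    intro n
    simp only [Pi.zero_apply, map_zero]
  neg_mem' := by
    intro f hf n
    simp only [Pi.neg_apply, map_neg, hf n]

/-- `f = ∑_n c_n R_n` in the completed algebra. -/
def HasExpansion (f : Completed) (c : ℕ → K) : Prop :=
  ∀ N : ℕ, (f : ∀ n : ℕ, K[X] ⧸ Ideal.span {RK n}) N =
    Ideal.Quotient.mk _ (∑ n ∈ Finset.range N, C (c n) * RK n)

/-- `f = ∑_n c_n R_n` satisfies `⟨f, x⟩ = ⟨t(x)⟩` for every even `x`, where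
`⟨f, x⟩ = ∑_n c_n ⟨R_n, x⟩` is a finite sum (its partial sums are eventually constant). -/
def InducesTwist (f : Completed) : Prop :=
  ∃ c : ℕ → K, HasExpansion f c ∧ ∀ x ∈ evenPart, ∀ᶠ N in Filter.atTop,
    ∑ n ∈ Finset.range N, c n * algebraMap Ground K (pairing (R n) x) =
      algebraMap Ground K (value (twist x))

/-! ### The quantities in the formula -/

/-- `A` as an element of `ℚ(A)`. -/
def AK : K := algebraMap Ground K (A 1)

/-- `a = A ^ 2` as an element of `ℚ(A)`. -/
def aK : K := AK ^ 2

/-- The quantum integer `[n] = (a^n - a^{-n}) / (a - a^{-1})`. -/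
def qInt (n : ℕ) : K := (aK ^ n - (aK ^ n)⁻¹) / (aK - aK⁻¹)

/-- The quantum factorial `[n]! = [1] [2] ⋯ [n]`. -/
def qFactorial (n : ℕ) : K := ∏ i ∈ Finset.range n, qInt (i + 1)

/-- The twist eigenvalues `μ_i = (-1)^i A^{i² + 2i}`. -/
def mu (i : ℕ) : K := (-1) ^ i * AK ^ (i ^ 2 + 2 * i)

end

end KauffmanSkein

namespace KauffmanSkein

noncomputable section

/-! Both sides of the defining condition on `ω` are diagonal in the Chebyshev basis e_n = `cheb n`.
The closure of e_n in the plane has value (-1)^n [n+1]; encircling it by a core multiplies this by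
λ_n, and a full twist multiplies it by μ_n (`pairing_cheb`, `value_twist_cheb`). The e_{2k} span the
even part, so the condition says exactly that ω takes the value μ_{2k} at λ_{2k} for every k
(`inducesTwist_iff`). The points λ_{2k} are distinct, hence congruence modulo R_n is equality of
values at the first n of them: an expansion is determined by its values, every sequence of values
occurs, and multiplication is pointwise (`ofValues`). So ω exists, is unique, is invertible because
μ_{2k} ≠ 0, and ω^p has the values μ_{2k}^p. Its coefficients in the Newton basis R_n are divided
differences, whose denominators factor into quantum factorials (`prod_node_sub`).

The eigenvalues come from Temperley–Lieb theory, which has to be extracted from the combinatorial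
definition of the bracket. The two-colourings of the circles of a closed diagram are counted by the
trace of a product of 0/1 matrices (`trace_transferWord`), so matrix identities give the relations
between circle numbers. Words in the turn-backs modulo the radical of the resulting trace form a
Temperley–Lieb algebra with a Markov trace, and the bracket of a closed braid is a trace in it
(`algebraMap_bracket`).

The remaining topology is algebra over `IsTL` and `IsMarkov`. In an annular closure e_n may be
replaced by the Jones–Wenzl idempotent f_n, as Wenzl's recursion turns into the Chebyshev recursion
(`IsAnnular.apply_cheb`). Since f_n kills turn-backs, the full twist acts on it by a scalar; the
encircling scalar follows by computing a twisted idempotent in two ways (`cap_around_jonesWenzl`).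
-/

/-! ### Counting circles by counting their two-colourings -/

/-- Colourings `s`, `t` of the points below and above a turn-back at `i` that extend to its arcs. -/
def Extends (n i : ℕ) (s t : Fin n → Bool) : Prop :=
  (∀ j : Fin n, (j : ℕ) ≠ i → (j : ℕ) ≠ i + 1 → s j = t j) ∧
    (∀ p q : Fin n, (p : ℕ) = i → (q : ℕ) = i + 1 → s p = s q) ∧
    (∀ p q : Fin n, (p : ℕ) = i → (q : ℕ) = i + 1 → t p = t q)

open Classical in
/-- The transfer matrix of a turn-back. -/
def transfer (n i : ℕ) : Matrix (Fin n → Bool) (Fin n → Bool) ℕ :=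
  Matrix.of fun s t => if Extends n i s t then 1 else 0

/-- The transfer matrix of a word. -/
def transferWord (n : ℕ) (E : List ℕ) : Matrix (Fin n → Bool) (Fin n → Bool) ℕ :=
  (E.map (transfer n)).prod

/-- The number of circles of the closure of a crossingless diagram. -/
def circleCount (n : ℕ) (E : List ℕ) : ℕ := Nat.card (Circle n E)

instance (n : ℕ) (E : List ℕ) : Finite (Circle n E) :=
  inferInstanceAs (Finite (Quot _))

/-- An entry of a product of 0/1 matrices counts paths. The first letter is split off, the summation
index being the colouring at height 1. -/
theorem transferWord_apply (n : ℕ) (E : List ℕ) (s t : Fin n → Bool) :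
    transferWord n E s t = Nat.card {g : Fin (E.length + 1) → Fin n → Bool //
      g 0 = s ∧ g (Fin.last _) = t ∧
        ∀ k : Fin E.length, Extends n E[k] (g k.castSucc) (g k.succ)} := by
  classical
  induction E generalizing s with
  | nil =>
    simp only [transferWord, List.map_nil, List.prod_nil, Matrix.one_apply]
    split_ifs with h
    · subst h
      symm
      rw [Nat.card_eq_one_iff_unique]
      refine ⟨⟨?_⟩, ⟨⟨fun _ => s, rfl, rfl, fun k => k.elim0⟩⟩⟩
      rintro ⟨g, hg, -⟩ ⟨g', hg', -⟩
      ext k : 2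
      have : k = 0 := Subsingleton.elim (α := Fin 1) _ _
      subst this
      exact hg.trans hg'.symm
    · symm
      rw [Nat.card_eq_zero]
      left
      constructor
      rintro ⟨g, h1, h2, -⟩
      exact h (h1.symm.trans h2)
  | cons i E ih =>
    have e : {g : Fin ((i :: E).length + 1) → Fin n → Bool //
        g 0 = s ∧ g (Fin.last _) = t ∧
          ∀ k : Fin (i :: E).length, Extends n (i :: E)[k] (g k.castSucc) (g k.succ)} ≃
        Σ u : Fin n → Bool, {g : Fin (E.length + 1) → Fin n → Bool // Extends n i s u ∧
          (g 0 = u ∧ g (Fin.last _) = t ∧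
            ∀ k : Fin E.length, Extends n E[k] (g k.castSucc) (g k.succ))} :=
      { toFun := fun g => ⟨g.1 1, fun k => g.1 k.succ, by
          refine ⟨?_, rfl, g.2.2.1, fun k => ?_⟩
          · have h : Extends n i (g.1 0) (g.1 1) := g.2.2.2 0
            rwa [g.2.1] at h
          · exact g.2.2.2 k.succ⟩
        invFun := fun g => ⟨Fin.cons s g.2.1, rfl, g.2.2.2.2.1, fun k => by
            refine Fin.cases ?_ (fun k => ?_) k
            · have h : Extends n i s (g.2.1 0) := by
                rw [g.2.2.2.1]
                exact g.2.2.1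
              exact h
            · exact g.2.2.2.2.2 k⟩
        left_inv := by
          rintro ⟨g, h1, h2⟩
          ext k : 2
          refine Fin.cases ?_ (fun k => ?_) k
          · exact h1.symm
          · rfl
        right_inv := by
          rintro ⟨u, g, h1, h2, h3⟩
          subst h2
          rfl }
    rw [Nat.card_congr e, Nat.card_sigma]
    simp only [transferWord, List.map_cons, List.prod_cons, Matrix.mul_apply]
    refine Finset.sum_congr rfl fun u _ => ?_
    have := ih u
    rw [transferWord] at this
    rw [this, transfer, Matrix.of_apply]
    split_ifs with h
    · rw [one_mul]
      exact Nat.card_congr (Equiv.subtypeEquivRight fun g => by simp [h])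
    · rw [zero_mul]
      symm
      rw [Nat.card_eq_zero]
      left
      exact ⟨fun g => h g.2.1⟩

/-- A `Bool`-valued function on the circles is a colouring of the points that is constant along
arcs. The arcs `Joined.close` identify the top and bottom colourings, which is why diagonal entries
are summed. -/
theorem trace_transferWord (n : ℕ) (E : List ℕ) :
    (transferWord n E).trace = 2 ^ circleCount n E := by
  classical
  have e1 : (Circle n E → Bool) ≃ Σ s : Fin n → Bool, {g : Fin (E.length + 1) → Fin n → Bool //
      g 0 = s ∧ g (Fin.last _) = s ∧
        ∀ k : Fin E.length, Extends n E[k] (g k.castSucc) (g k.succ)} :=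
    { toFun := fun φ => ⟨fun j => φ (Quot.mk _ (0, j)), fun k j => φ (Quot.mk _ (k, j)), rfl,
        funext fun j => congrArg φ (Quot.sound (Joined.close j)), fun k =>
        ⟨fun j h h' => congrArg φ (Quot.sound (Joined.through k j h h')),
         fun p q h h' => congrArg φ (Quot.sound (Joined.cap k p q h h')),
         fun p q h h' => congrArg φ (Quot.sound (Joined.cup k p q h h'))⟩⟩
      invFun := fun g => Quot.lift (fun p => g.2.1 p.1 p.2) (by
        rintro _ _ (⟨k, j, h, h'⟩ | ⟨k, p, q, h, h'⟩ | ⟨k, p, q, h, h'⟩ | j)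
        · exact (g.2.2.2.2 k).1 j h h'
        · exact (g.2.2.2.2 k).2.1 p q h h'
        · exact (g.2.2.2.2 k).2.2 p q h h'
        · exact congrFun (g.2.2.2.1.trans g.2.2.1.symm) j)
      left_inv := by
        intro φ
        ext c
        induction c using Quot.ind
        rfl
      right_inv := by
        rintro ⟨s, g, h1, h2⟩
        subst h1
        rfl }
  have h := Nat.card_congr e1
  rw [Nat.card_sigma, Nat.card_fun, Nat.card_eq_fintype_card, Fintype.card_bool] at h
  rw [circleCount, h, Matrix.trace]
  exact Finset.sum_congr rfl fun s _ => transferWord_apply n E s s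

/-- The matrices only know the loop value 2, but powers of 2 determine their exponent, so the
relations between circle numbers hold and can be used at any loop value. -/
theorem circleCount_eq_of_trace {n m : ℕ} {E F : List ℕ} {k : ℕ}
    (h : (transferWord n E).trace = 2 ^ k * (transferWord m F).trace) :
    circleCount n E = circleCount m F + k := by
  rw [trace_transferWord, trace_transferWord, ← pow_add] at h
  rw [Nat.pow_right_injective le_rfl h, add_comm]

theorem transferWord_append (n : ℕ) (E F : List ℕ) :
    transferWord n (E ++ F) = transferWord n E * transferWord n F := by
  simp [transferWord]

theorem circleCount_append_comm (n : ℕ) (E F : List ℕ) :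
    circleCount n (E ++ F) = circleCount n (F ++ E) := by
  refine circleCount_eq_of_trace (k := 0) ?_
  rw [transferWord_append, transferWord_append, Matrix.trace_mul_comm, pow_zero, one_mul]

theorem circleCount_nil (n : ℕ) : circleCount n [] = n := by
  have h := trace_transferWord n []
  simp only [transferWord, List.map_nil, List.prod_nil, Matrix.trace_one, Fintype.card_pi,
    Fintype.card_bool, Finset.prod_const, Finset.card_univ, Fintype.card_fin, Nat.cast_pow] at h
  exact (Nat.pow_right_injective le_rfl h).symm

/-- Recolouring of the points `i` and `i + 1` by the colour `x`. -/
def recolour {n : ℕ} (i : ℕ) (x : Bool) (s : Fin n → Bool) (j : Fin n) : Bool :=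
  if (j : ℕ) = i ∨ (j : ℕ) = i + 1 then x else s j

/-- The colours at `i` and `i + 1` must agree on one side and are again equal, but free, on the
other. The relations between turn-backs are checked on vectors through this formula. -/
theorem transfer_mulVec {n i : ℕ} (hi : i + 1 < n) (v : (Fin n → Bool) → ℕ) (s : Fin n → Bool) :
    (transfer n i).mulVec v s = if s ⟨i, by omega⟩ = s ⟨i + 1, hi⟩ then
      v (recolour i false s) + v (recolour i true s) else 0 := by
  classical
  have key : ∀ t, Extends n i s t ↔ s ⟨i, by omega⟩ = s ⟨i + 1, hi⟩ ∧
      (t = recolour i false s ∨ t = recolour i true s) := by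
    intro t
    constructor
    · rintro ⟨h1, h2, h3⟩
      refine ⟨h2 _ _ rfl rfl, ?_⟩
      have h4 := h3 ⟨i, by omega⟩ ⟨i + 1, hi⟩ rfl rfl
      have : t = recolour i (t ⟨i, by omega⟩) s := by
        ext j
        simp only [recolour]
        split_ifs with h
        · rcases h with h | h
          · exact congrArg t (Fin.ext h)
          · rw [h4]
            exact congrArg t (Fin.ext h)
        · push Not at h
          exact (h1 j h.1 h.2).symm
      cases h : t ⟨i, by omega⟩
      · left
        rw [this, h]
      · right
        rw [this, h]
    · rintro ⟨h1, h2⟩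
      have : ∃ x, t = recolour i x s := by
        rcases h2 with h2 | h2
        · exact ⟨_, h2⟩
        · exact ⟨_, h2⟩
      obtain ⟨x, rfl⟩ := this
      refine ⟨fun j hj hj' => ?_, fun p q hp hq => ?_, fun p q hp hq => ?_⟩
      · simp [recolour, hj, hj']
      · have h3 : p = ⟨i, Nat.lt_of_succ_lt hi⟩ := Fin.ext hp
        have h4 : q = ⟨i + 1, hi⟩ := Fin.ext hq
        rw [h3, h4]
        exact h1
      · simp [recolour, hp, hq]
  have hne : recolour i false s ≠ recolour i true s := by
    intro h
    have := congrFun h ⟨i, by omega⟩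
    simp [recolour] at this
  simp only [Matrix.mulVec, dotProduct, transfer, Matrix.of_apply, key]
  split_ifs with h
  · have : ∀ t, (if (s ⟨i, by omega⟩ = s ⟨i + 1, hi⟩ ∧
        (t = recolour i false s ∨ t = recolour i true s)) then 1 else 0) * v t =
        (if t = recolour i false s then v t else 0) + (if t = recolour i true s then v t else 0) := by
      intro t
      by_cases h1 : t = recolour i false s
      · have h2 : t ≠ recolour i true s := h1 ▸ hne
        simp [h, h1, hne]
      · by_cases h2 : t = recolour i true s
        · simp [h, h2, hne.symm]
        · simp [h1, h2]
    simp [this, Finset.sum_add_distrib]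
  · simp [h]

theorem transfer_sq {n i : ℕ} (hi : i + 1 < n) :
    transfer n i * transfer n i = 2 • transfer n i := by
  apply Matrix.toLin'.injective
  refine LinearMap.ext fun v => funext fun s => ?_
  have h1 : ∀ x y, recolour i x (recolour i y s) = recolour i x s := by
    intro x y; ext j; simp only [recolour]; split_ifs <;> rfl
  simp only [Matrix.toLin'_apply, ← Matrix.mulVec_mulVec, Matrix.smul_mulVec, Pi.smul_apply,
    transfer_mulVec hi, h1]
  simp [recolour, two_mul]

theorem transfer_up {n i : ℕ} (hi : i + 2 < n) :
    transfer n i * transfer n (i + 1) * transfer n i = transfer n i := by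
  apply Matrix.toLin'.injective
  refine LinearMap.ext fun v => funext fun s => ?_
  have h1 : ∀ x y z, s ⟨i + 2, hi⟩ = y →
      recolour i x (recolour (i + 1) y (recolour i z s)) = recolour i x s := by
    intro x y z hy; ext j; simp only [recolour]
    split_ifs with h h' <;> try rfl
    obtain rfl : j = ⟨i + 2, hi⟩ := Fin.ext (by simp only; omega)
    exact hy.symm
  simp only [Matrix.toLin'_apply, ← Matrix.mulVec_mulVec,
    transfer_mulVec (show i + 1 < n by omega), transfer_mulVec (show i + 1 + 1 < n by omega)]
  have b1 : i ≠ i + 1 + 1 := by omega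
  have b2 : i + 1 + 1 ≠ i := by omega
  congr 1
  cases hy : s ⟨i + 2, hi⟩ <;> simp [recolour, hy, h1 _ _ _ hy, b1, b2]

theorem transfer_down {n i : ℕ} (hi : i + 2 < n) :
    transfer n (i + 1) * transfer n i * transfer n (i + 1) = transfer n (i + 1) := by
  apply Matrix.toLin'.injective
  refine LinearMap.ext fun v => funext fun s => ?_
  have h1 : ∀ x y z, s ⟨i, by omega⟩ = y →
      recolour (i + 1) x (recolour i y (recolour (i + 1) z s)) = recolour (i + 1) x s := by
    intro x y z hy; ext j; simp only [recolour]
    split_ifs with h h' <;> try rfl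
    obtain rfl : j = ⟨i, by omega⟩ := Fin.ext (by simp only; omega)
    exact hy.symm
  simp only [Matrix.toLin'_apply, ← Matrix.mulVec_mulVec,
    transfer_mulVec (show i + 1 < n by omega), transfer_mulVec (show i + 1 + 1 < n by omega)]
  have b1 : i ≠ i + 1 + 1 := by omega
  have b2 : i + 1 + 1 ≠ i := by omega
  congr 1
  cases hy : s ⟨i, by omega⟩ <;> simp [recolour, hy, h1 _ _ _ hy, b1, b2]

theorem transfer_comm {n i j : ℕ} (hij : i + 2 ≤ j) (hj : j + 1 < n) :
    transfer n i * transfer n j = transfer n j * transfer n i := by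
  apply Matrix.toLin'.injective
  refine LinearMap.ext fun v => funext fun s => ?_
  have h1 : ∀ x y, recolour i x (recolour j y s) = recolour j y (recolour i x s) := by
    intro x y; ext k; simp only [recolour]
    split_ifs with h h' <;> first | rfl | omega
  simp only [Matrix.toLin'_apply, ← Matrix.mulVec_mulVec,
    transfer_mulVec (show i + 1 < n by omega), transfer_mulVec hj, h1]
  have a1 : j ≠ i := by omega
  have a2 : j ≠ i + 1 := by omega
  have a3 : j + 1 ≠ i := by omega
  simp only [recolour, a1, a2, a3, Nat.add_right_cancel_iff, or_self, if_false, a1.symm, a2.symm,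
    a3.symm]
  split_ifs <;> first | rfl | ring

theorem extends_snoc {n i : ℕ} (hi : i + 1 < n) (s t : Fin n → Bool) (x y : Bool) :
    Extends (n + 1) i (Fin.snoc (α := fun _ => Bool) s x) (Fin.snoc (α := fun _ => Bool) t y) ↔
      Extends n i s t ∧ x = y := by
  have h1 : n ≠ i := by omega
  have h2 : n ≠ i + 1 := by omega
  simp only [Extends, Fin.forall_fin_succ', Fin.snoc_castSucc, Fin.snoc_last, Fin.val_castSucc,
    Fin.val_last, h1, h2, ne_eq, not_false_eq_true, true_imp_iff, false_imp_iff, implies_true,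
    and_true]
  tauto

theorem sum_snoc {n : ℕ} (v : (Fin (n + 1) → Bool) → ℕ) :
    ∑ s, v s = ∑ x : Bool, ∑ s : Fin n → Bool, v (Fin.snoc (α := fun _ => Bool) s x) := by
  rw [← Fintype.sum_prod_type']
  exact (Fintype.sum_equiv (Fin.snocEquiv (fun _ => Bool)) _ _ fun _ => rfl).symm

theorem transfer_snoc {n i : ℕ} (hi : i + 1 < n) (s t : Fin n → Bool) (x y : Bool) :
    transfer (n + 1) i (Fin.snoc (α := fun _ => Bool) s x) (Fin.snoc (α := fun _ => Bool) t y) =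
      if x = y then transfer n i s t else 0 := by
  have h := extends_snoc hi s t x y
  simp only [transfer, Matrix.of_apply]
  split_ifs <;> simp_all

/-- A strand that the word does not touch keeps its colour: the matrix is tensored with a 2 × 2
identity, which doubles the trace. -/
theorem transferWord_snoc {n : ℕ} {E : List ℕ} (hE : ∀ i ∈ E, i + 1 < n) (s t : Fin n → Bool)
    (x y : Bool) :
    transferWord (n + 1) E (Fin.snoc (α := fun _ => Bool) s x)
      (Fin.snoc (α := fun _ => Bool) t y) = if x = y then transferWord n E s t else 0 := by
  induction E generalizing s x with
  | nil =>
    have : Fin.snoc (α := fun _ => Bool) s x = Fin.snoc (α := fun _ => Bool) t y ↔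
        x = y ∧ s = t := by
      rw [Fin.snoc_inj]
      tauto
    simp only [transferWord, List.map_nil, List.prod_nil, Matrix.one_apply, this]
    split_ifs <;> simp_all
  | cons i E ih =>
    rw [List.forall_mem_cons] at hE
    have h1 : ∀ (m : ℕ) (u v : Fin m → Bool), transferWord m (i :: E) u v =
        ∑ w, transfer m i u w * transferWord m E w v := by
      intro m u v
      simp only [transferWord, List.map_cons, List.prod_cons, Matrix.mul_apply]
    rw [h1, h1, sum_snoc]
    simp only [ih hE.2, transfer_snoc hE.1]
    rw [Finset.sum_eq_single x]
    · split_ifs <;> simp_all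
    · intro z _ hz
      simp [Ne.symm hz]
    · simp

theorem circleCount_succ {n : ℕ} {E : List ℕ} (hE : ∀ i ∈ E, i + 1 < n) :
    circleCount (n + 1) E = circleCount n E + 1 := by
  refine circleCount_eq_of_trace ?_
  simp only [Matrix.trace, Matrix.diag_apply]
  rw [sum_snoc]
  simp [transferWord_snoc hE, two_mul]

theorem circleCount_add {n : ℕ} {E : List ℕ} (hE : ∀ i ∈ E, i + 1 < n) (k : ℕ) :
    circleCount (n + k) E = circleCount n E + k := by
  induction k with
  | zero => rfl
  | succ k ih =>
    rw [← add_assoc, circleCount_succ fun i hi => (hE i hi).trans_le (Nat.le_add_right _ _), ih]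
    rfl

/-- Tracing out the last colour in the turn-back at `n` leaves the identity on `n + 1` strands,
since that colour is forced to be the one of the neighbouring strand. -/
theorem circleCount_markov {n : ℕ} {E : List ℕ} (hE : ∀ i ∈ E, i + 1 < n + 1) :
    circleCount (n + 2) (E ++ [n]) = circleCount (n + 1) E := by
  refine circleCount_eq_of_trace (k := 0) ?_
  have h1 : ∀ (s t : Fin (n + 1) → Bool) (x : Bool),
      transferWord (n + 2) [n] (Fin.snoc (α := fun _ => Bool) t x)
        (Fin.snoc (α := fun _ => Bool) s x) =
      if x = s (Fin.last n) then (if t = s then 1 else 0) else 0 := by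
    intro s t x
    have : Extends (n + 2) n (Fin.snoc (α := fun _ => Bool) t x)
        (Fin.snoc (α := fun _ => Bool) s x) ↔ x = s (Fin.last n) ∧ t = s := by
      simp only [Extends, Fin.forall_fin_succ' (n := n + 1), Fin.snoc_castSucc, Fin.snoc_last,
        Fin.val_castSucc, Fin.val_last, funext_iff]
      simp only [Fin.forall_fin_succ' (n := n), Fin.val_castSucc, Fin.val_last]
      have a1 : ∀ j : Fin n, (j : ℕ) ≠ n := fun j => j.2.ne
      have a2 : ∀ j : Fin n, (j : ℕ) ≠ n + 1 := fun j => by omega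
      simp [a1, a2]
      grind
    classical
    simp only [transferWord, List.map_cons, List.map_nil, List.prod_cons, List.prod_nil, mul_one,
      transfer, Matrix.of_apply, this]
    split_ifs <;> simp_all
  rw [transferWord_append]
  simp only [Matrix.trace, Matrix.diag_apply, Matrix.mul_apply, pow_zero, one_mul]
  rw [sum_snoc, Finset.sum_comm]
  refine Finset.sum_congr rfl fun s _ => ?_
  simp only [sum_snoc (n := n + 1), transferWord_snoc hE]
  rw [Finset.sum_eq_single (s (Fin.last n)), Finset.sum_eq_single (s (Fin.last n))]
  · simp [h1]
  · intro z _ hz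
    simp [Ne.symm hz]
  · simp
  · intro x _ hx
    rw [Finset.sum_eq_single x]
    · simp [h1, hx]
    · intro z _ hz
      simp [Ne.symm hz]
    · simp
  · simp

theorem transferWord_congr {n : ℕ} (u v : List ℕ) {w w' : List ℕ}
    (h : transferWord n w = transferWord n w') :
    circleCount n (u ++ w ++ v) = circleCount n (u ++ w' ++ v) := by
  refine circleCount_eq_of_trace (k := 0) ?_
  simp only [transferWord_append, h, pow_zero, one_mul]

theorem circleCount_sq {n i : ℕ} (hi : i + 1 < n) (u v : List ℕ) :
    circleCount n (u ++ [i, i] ++ v) = circleCount n (u ++ [i] ++ v) + 1 := by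
  refine circleCount_eq_of_trace ?_
  have : transferWord n [i, i] = 2 • transferWord n [i] := by
    simp [transferWord, transfer_sq hi]
  simp only [transferWord_append, this, mul_smul_comm, smul_mul_assoc, Matrix.trace_smul, pow_one,
    smul_eq_mul]

theorem circleCount_up {n i : ℕ} (hi : i + 2 < n) (u v : List ℕ) :
    circleCount n (u ++ [i, i + 1, i] ++ v) = circleCount n (u ++ [i] ++ v) :=
  transferWord_congr u v (by simp [transferWord, ← mul_assoc, transfer_up hi])

theorem circleCount_down {n i : ℕ} (hi : i + 2 < n) (u v : List ℕ) :
    circleCount n (u ++ [i + 1, i, i + 1] ++ v) = circleCount n (u ++ [i + 1] ++ v) :=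
  transferWord_congr u v (by simp [transferWord, ← mul_assoc, transfer_down hi])

theorem circleCount_comm {n i j : ℕ} (hij : i + 2 ≤ j) (hj : j + 1 < n) (u v : List ℕ) :
    circleCount n (u ++ [i, j] ++ v) = circleCount n (u ++ [j, i] ++ v) :=
  transferWord_congr u v (by simp [transferWord, transfer_comm hij hj])

/-! ### The variable in the fraction field -/

theorem algebraMap_A_natCast (n : ℕ) : algebraMap Ground K (A n) = AK ^ n := by
  rw [AK, ← map_pow, A, A, LaurentPolynomial.T_pow, mul_one]

theorem AK_pow_ne_one {n : ℕ} (hn : n ≠ 0) : AK ^ n ≠ 1 := by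
  rw [← algebraMap_A_natCast, ← map_one (algebraMap Ground K)]
  intro h
  have h' := IsFractionRing.injective Ground K h
  rw [A, ← LaurentPolynomial.T_zero] at h'
  have h2 := congrArg (fun f : Ground => f.coeff (n : ℤ)) h'
  simp only [LaurentPolynomial.T, AddMonoidAlgebra.coeff_single, Finsupp.single_apply, if_true,
    (Nat.cast_ne_zero.2 hn).symm, if_false] at h2
  exact one_ne_zero h2

theorem AK_ne_zero : AK ≠ 0 := by
  intro h
  have h1 : algebraMap Ground K (A 1 * A (-1)) = 1 := by
    rw [A, A, ← LaurentPolynomial.T_add]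
    simp
  rw [map_mul, show algebraMap Ground K (A 1) = AK from rfl, h, zero_mul] at h1
  exact zero_ne_one h1

theorem algebraMap_A_neg (n : ℕ) : algebraMap Ground K (A (-n)) = (AK ^ n)⁻¹ := by
  have h1 : algebraMap Ground K (A n * A (-n)) = 1 := by
    rw [A, A, ← LaurentPolynomial.T_add]
    simp
  rw [map_mul, algebraMap_A_natCast] at h1
  exact eq_inv_of_mul_eq_one_right h1

/-- The value of a circle in `ℚ(A)`. -/
def delta : K := algebraMap Ground K circleValue

theorem delta_eq : delta = -AK ^ 2 - (AK ^ 2)⁻¹ := by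
  have h1 := algebraMap_A_natCast 2
  have h2 := algebraMap_A_neg 2
  rw [delta, circleValue, a, a, map_sub, map_neg, ← h2, ← h1]
  rfl

theorem delta_ne_zero : delta ≠ 0 := by
  rw [delta_eq]
  intro h
  have h0 := AK_ne_zero
  have h1 : AK ^ 4 = -1 := by
    field_simp at h
    linear_combination -h
  apply AK_pow_ne_one (n := 8) (by norm_num)
  linear_combination (AK ^ 4 - 1) * h1

/-! ### The Markov trace on words in the turn-backs -/

/-- The normalized value of the closure of a word in the turn-backs. -/
def wordTrace (w : List ℕ) : K := delta ^ circleCount (w.sum + 2) w / delta ^ (w.sum + 2)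

/-- Any sufficiently large number of strands may replace `w.sum + 2`: a further strand adds one
circle and one factor to the denominator. The normalization thus lets words on different numbers of
strands share one algebra. -/
theorem wordTrace_eq {n : ℕ} {w : List ℕ} (h : ∀ i ∈ w, i + 1 < n) :
    wordTrace w = delta ^ circleCount n w / delta ^ n := by
  have h' : ∀ i ∈ w, i + 1 < w.sum + 2 := fun i hi => by
    have := List.le_sum_of_mem hi
    omega
  have e1 := circleCount_add h (w.sum + 2)
  have e2 := circleCount_add h' n
  rw [add_comm (w.sum + 2) n, e1] at e2
  have hd := delta_ne_zero
  rw [wordTrace, div_eq_div_iff (pow_ne_zero _ hd) (pow_ne_zero _ hd), ← pow_add, ← pow_add, e2]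

/-- Formal linear combinations of words in the turn-backs. -/
abbrev WordAlgebra : Type := MonoidAlgebra K (FreeMonoid ℕ)

/-- A word as an element of the algebra of words. -/
def word (w : List ℕ) : WordAlgebra := MonoidAlgebra.of K _ (FreeMonoid.ofList w)

theorem word_append (u v : List ℕ) : word (u ++ v) = word u * word v := by
  rw [word, FreeMonoid.ofList_append, map_mul, word, word]

theorem word_nil : word [] = 1 := by
  rw [word, FreeMonoid.ofList_nil, map_one]

theorem word_induction {P : WordAlgebra → Prop} (x : WordAlgebra) (hw : ∀ w, P (word w))
    (hadd : ∀ x y, P x → P y → P (x + y)) (hsmul : ∀ (c : K) x, P x → P (c • x)) : P x :=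
  MonoidAlgebra.induction_on x (fun w => hw (FreeMonoid.toList w)) hadd hsmul

/-- The linear extension of `wordTrace`. -/
def preTrace : WordAlgebra →ₗ[K] K :=
  Finsupp.linearCombination K (fun w : FreeMonoid ℕ => wordTrace w.toList) ∘ₗ
    (MonoidAlgebra.coeffLinearEquiv K).toLinearMap

theorem preTrace_word (w : List ℕ) : preTrace (word w) = wordTrace w := by
  simp [preTrace, word, MonoidAlgebra.coeffLinearEquiv]

theorem preTrace_mul_comm (x y : WordAlgebra) : preTrace (x * y) = preTrace (y * x) := by
  induction x using word_induction with
  | hw u =>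
    induction y using word_induction with
    | hw v =>
      rw [← word_append, ← word_append, preTrace_word, preTrace_word]
      have h : ∀ i ∈ u ++ v, i + 1 < (u ++ v).sum + 2 := fun i hi => by
        have := List.le_sum_of_mem hi
        omega
      have h' : ∀ i ∈ v ++ u, i + 1 < (u ++ v).sum + 2 := fun i hi => h i (by grind)
      rw [wordTrace_eq h, wordTrace_eq h', circleCount_append_comm]
    | hadd y z hy hz => rw [mul_add, add_mul, map_add, map_add, hy, hz]
    | hsmul c y hy => rw [mul_smul_comm, smul_mul_assoc, map_smul, map_smul, hy]
  | hadd y z hy hz => rw [mul_add, add_mul, map_add, map_add, hy, hz]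
  | hsmul c y hy => rw [mul_smul_comm, smul_mul_assoc, map_smul, map_smul, hy]

/-- Two elements are congruent if all closures of them agree. -/
def closureCon : RingCon WordAlgebra where
  r x y := ∀ u v, preTrace (u * x * v) = preTrace (u * y * v)
  iseqv := ⟨fun _ _ _ => rfl, fun h u v => (h u v).symm, fun h h' u v => (h u v).trans (h' u v)⟩
  add' h h' u v := by simp only [mul_add, add_mul, map_add, h u v, h' u v]
  mul' {w x y z} h h' u v := by
    rw [← mul_assoc, mul_assoc (u * w), h u (y * v), mul_assoc, ← mul_assoc x, ← mul_assoc,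
      ← mul_assoc, h' (u * x) v, mul_assoc u]

theorem closureCon_of_words {x y : WordAlgebra}
    (h : ∀ u v, preTrace (word u * x * word v) = preTrace (word u * y * word v)) :
    closureCon x y := by
  intro u v
  induction u using word_induction with
  | hw u =>
    induction v using word_induction with
    | hw v => exact h u v
    | hadd y z hy hz => rw [mul_add, mul_add, map_add, map_add, hy, hz]
    | hsmul c y hy => rw [mul_smul_comm, mul_smul_comm, map_smul, map_smul, hy]
  | hadd y z hy hz => simp only [add_mul, map_add, hy, hz]
  | hsmul c y hy => simp only [smul_mul_assoc, map_smul, hy]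

/-- The Temperley–Lieb algebra on infinitely many strands, modulo the radical of its trace. -/
abbrev TLAlgebra : Type := closureCon.Quotient

/-- The quotient map. -/
def toTL : WordAlgebra →ₐ[K] TLAlgebra := closureCon.mkₐ K

/-- The Markov trace. -/
def markovTrace : TLAlgebra →ₗ[K] K where
  toFun := Quotient.lift preTrace fun x y h => by simpa using h 1 1
  map_add' x y := by
    induction x using Quotient.inductionOn'
    induction y using Quotient.inductionOn'
    exact map_add preTrace _ _
  map_smul' c x := by
    induction x using Quotient.inductionOn'
    exact map_smul preTrace _ _

/-- The turn-back at position `i` in the Temperley–Lieb algebra. -/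
def turnBack (i : ℕ) : TLAlgebra := toTL (word [i])

theorem markovTrace_toTL (x : WordAlgebra) : markovTrace (toTL x) = preTrace x := rfl

theorem toTL_surjective : Function.Surjective toTL := closureCon.mkₐ_surjective

theorem toTL_eq {x y : WordAlgebra} (h : closureCon x y) : toTL x = toTL y :=
  Quotient.sound h

theorem toTL_word (w : List ℕ) : toTL (word w) = (w.map turnBack).prod := by
  induction w with
  | nil => simp [word_nil]
  | cons i w ih =>
    rw [List.map_cons, List.prod_cons, ← ih, turnBack, ← map_mul, ← word_append]
    rfl

/-! ### Temperley–Lieb relations and Markov traces in an abstract algebra -/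

section Abstract

variable {B : Type*} [Ring B] [Algebra K B]

/-- The Temperley–Lieb relations for a sequence of turn-backs. -/
structure IsTL (E : ℕ → B) : Prop where
  sq (i : ℕ) : E i * E i = delta • E i
  up (i : ℕ) : E i * E (i + 1) * E i = E i
  down (i : ℕ) : E (i + 1) * E i * E (i + 1) = E (i + 1)
  comm {i j : ℕ} (h : i + 2 ≤ j) : E i * E j = E j * E i

/-- The subalgebra generated by the turn-backs on the first `n` strands. -/
def strands (E : ℕ → B) (n : ℕ) : Subalgebra K B :=
  Algebra.adjoin K {x | ∃ i, i + 1 < n ∧ x = E i}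

/-- Normalized Markov traces. -/
structure IsMarkov (E : ℕ → B) (τ : B →ₗ[K] K) : Prop where
  one : τ 1 = 1
  mul_comm (x y : B) : τ (x * y) = τ (y * x)
  markov {n : ℕ} {x : B} (hx : x ∈ strands E (n + 1)) : delta * τ (x * E n) = τ x

theorem strands_induction {E : ℕ → B} {n : ℕ} {P : B → Prop} {x : B} (hx : x ∈ strands E n)
    (hw : ∀ w : List ℕ, (∀ i ∈ w, i + 1 < n) → P (w.map E).prod)
    (hadd : ∀ x y, P x → P y → P (x + y)) (hsmul : ∀ (c : K) x, P x → P (c • x)) : P x := by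
  rw [strands, ← Subalgebra.mem_toSubmodule, Algebra.adjoin_eq_span] at hx
  refine Submodule.span_induction ?_ ?_ (fun x y _ _ => hadd x y) (fun c x _ => hsmul c x) hx
  · intro y hy
    suffices ∃ w : List ℕ, (∀ i ∈ w, i + 1 < n) ∧ y = (w.map E).prod by
      obtain ⟨w, h, rfl⟩ := this
      exact hw w h
    refine Submonoid.closure_induction ?_ ?_ ?_ hy
    · rintro _ ⟨i, hi, rfl⟩
      exact ⟨[i], by simpa using hi, by simp⟩
    · exact ⟨[], by simp, by simp⟩
    · rintro _ _ _ _ ⟨u, hu, rfl⟩ ⟨v, hv, rfl⟩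
      refine ⟨u ++ v, fun i hi => ?_, by simp⟩
      rcases List.mem_append.1 hi with h | h
      · exact hu i h
      · exact hv i h
  · have := hsmul 0 _ (hw [] (by simp))
    rwa [zero_smul] at this

end Abstract

/-- Elements all of whose closures agree have been identified, so each relation reduces to the
corresponding local change of circle numbers inside an arbitrary word. -/
theorem isTL_turnBack : IsTL turnBack where
  sq i := by
    rw [turnBack, ← map_mul, ← map_smul, ← word_append]
    refine toTL_eq (closureCon_of_words fun u v => ?_)
    rw [mul_smul_comm, smul_mul_assoc, map_smul]
    simp only [← word_append, preTrace_word]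
    have h : ∀ j ∈ u ++ ([i] ++ [i]) ++ v, j + 1 < (u ++ [i] ++ v).sum + 2 := fun j hj => by
      have := List.le_sum_of_mem (show j ∈ u ++ [i] ++ v by grind)
      omega
    have h' : ∀ j ∈ u ++ [i] ++ v, j + 1 < (u ++ [i] ++ v).sum + 2 := fun j hj => h j (by grind)
    rw [wordTrace_eq h, wordTrace_eq h']
    have := circleCount_sq (h i (by simp)) u v
    rw [show [i] ++ [i] = [i, i] from rfl, this, pow_succ, smul_eq_mul]
    ring
  up i := by
    simp only [turnBack, ← map_mul, ← word_append]
    refine toTL_eq (closureCon_of_words fun u v => ?_)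
    simp only [← word_append, preTrace_word]
    have h : ∀ j ∈ u ++ ([i] ++ [i + 1] ++ [i]) ++ v,
        j + 1 < (u ++ ([i] ++ [i + 1] ++ [i]) ++ v).sum + 2 := fun j hj => by
      have := List.le_sum_of_mem hj
      omega
    rw [wordTrace_eq h, wordTrace_eq fun j (hj : j ∈ u ++ [i] ++ v) => h j (by grind)]
    exact congrArg (fun k => delta ^ k / _) (circleCount_up (h (i + 1) (by simp)) u v)
  down i := by
    simp only [turnBack, ← map_mul, ← word_append]
    refine toTL_eq (closureCon_of_words fun u v => ?_)
    simp only [← word_append, preTrace_word]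
    have h : ∀ j ∈ u ++ ([i + 1] ++ [i] ++ [i + 1]) ++ v,
        j + 1 < (u ++ ([i + 1] ++ [i] ++ [i + 1]) ++ v).sum + 2 := fun j hj => by
      have := List.le_sum_of_mem hj
      omega
    rw [wordTrace_eq h, wordTrace_eq fun j (hj : j ∈ u ++ [i + 1] ++ v) => h j (by grind)]
    exact congrArg (fun k => delta ^ k / _) (circleCount_down (h (i + 1) (by simp)) u v)
  comm {i j} hij := by
    simp only [turnBack, ← map_mul, ← word_append]
    refine toTL_eq (closureCon_of_words fun u v => ?_)
    simp only [← word_append, preTrace_word]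
    have h : ∀ k ∈ u ++ ([i] ++ [j]) ++ v, k + 1 < (u ++ ([i] ++ [j]) ++ v).sum + 2 :=
      fun k hk => by
        have := List.le_sum_of_mem hk
        omega
    rw [wordTrace_eq h, wordTrace_eq fun k (hk : k ∈ u ++ ([j] ++ [i]) ++ v) => h k (by grind)]
    exact congrArg (fun k => delta ^ k / _) (circleCount_comm hij (h j (by simp)) u v)

theorem markovTrace_word (w : List ℕ) : markovTrace (w.map turnBack).prod = wordTrace w := by
  rw [← toTL_word, markovTrace_toTL, preTrace_word]

theorem isMarkov_markovTrace : IsMarkov turnBack markovTrace where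
  one := by
    have h := markovTrace_word []
    rw [wordTrace_eq (n := 0) (by simp), circleCount_nil, List.map_nil, List.prod_nil] at h
    simpa using h
  mul_comm x y := by
    obtain ⟨x, rfl⟩ := toTL_surjective x
    obtain ⟨y, rfl⟩ := toTL_surjective y
    rw [← map_mul, ← map_mul, markovTrace_toTL, markovTrace_toTL, preTrace_mul_comm]
  markov {n x} hx := by
    refine strands_induction (P := fun x => delta * markovTrace (x * turnBack n) = markovTrace x)
      hx (fun w hw => ?_) (fun x y hx hy => ?_) (fun c x hx => ?_)
    · have h1 := markovTrace_word (w ++ [n])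
      rw [List.map_append, List.prod_append, List.map_singleton, List.prod_singleton] at h1
      have h2 : ∀ i ∈ w ++ [n], i + 1 < n + 2 := by
        intro i hi
        rcases List.mem_append.1 hi with h | h
        · have := hw i h
          omega
        · simp only [List.mem_singleton] at h
          omega
      rw [h1, markovTrace_word, wordTrace_eq hw, wordTrace_eq h2, circleCount_markov hw]
      have := delta_ne_zero
      field_simp
      ring
    · rw [add_mul, map_add, mul_add, hx, hy, map_add]
    · rw [smul_mul_assoc, map_smul, map_smul, ← hx, smul_eq_mul, smul_eq_mul, mul_left_comm]

/-! ### The bracket as a trace -/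

section Braid

variable {B : Type*} [Ring B] [Algebra K B]

/-- The positive crossing, resolved. -/
def crossing (E : ℕ → B) (i : ℕ) : B := AK • 1 + AK⁻¹ • E i

/-- The value of an elementary piece; a positive curl is worth `-A³`. -/
def pieceValue (E : ℕ → B) : Piece → B
  | Piece.cross i => crossing E i
  | Piece.curl _ => (-AK ^ 3) • 1

/-- The value of a braid-like diagram. -/
def braidValue (E : ℕ → B) (D : List Piece) : B := (D.map (pieceValue E)).prod

theorem braidValue_append (E : ℕ → B) (D D' : List Piece) :
    braidValue E (D ++ D') = braidValue E D * braidValue E D' := by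
  simp [braidValue]

end Braid

/-- All crossings of the diagram fit on `n` strands. -/
def Fits (n : ℕ) (D : List Piece) : Prop := ∀ i, Piece.cross i ∈ D → i + 1 < n

theorem eval_flatClass (n : ℕ) (E : List ℕ) :
    (flatClass n E).eval circleValue = circleValue ^ circleCount n E := by
  classical
  have : circleCount n E = Nat.card {c : Circle n E // ¬ c.Essential} +
      Nat.card {c : Circle n E // c.Essential} := by
    rw [circleCount, add_comm, ← Nat.card_sum]
    exact Nat.card_congr (Equiv.sumCompl _).symm
  rw [flatClass, this, pow_add]
  simp

/-- The two smoothings are the two terms of `crossing`, and a curl gives the scalar Aδ + A⁻¹ = -A³.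
The part already smoothed is kept general for the induction. -/
theorem eval_resolve {n : ℕ} {D : List Piece} (hD : Fits n D) {E : List ℕ}
    (hE : ∀ i ∈ E, i + 1 < n) :
    algebraMap Ground K ((resolve n D E).eval circleValue) =
      delta ^ n * markovTrace ((E.map turnBack).prod * braidValue turnBack D) := by
  have hA1 : algebraMap Ground K (A (-1)) = AK⁻¹ := by simpa using algebraMap_A_neg 1
  have hA : algebraMap Ground K (A 1) = AK := rfl
  induction D generalizing E with
  | nil =>
    rw [resolve, eval_flatClass, map_pow, braidValue, List.map_nil, List.prod_nil, mul_one,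
      markovTrace_word, wordTrace_eq hE]
    have := delta_ne_zero
    field_simp
    rfl
  | cons p D ih =>
    have hD' : Fits n D := fun i hi => hD i (List.mem_cons_of_mem _ hi)
    cases p with
    | cross i =>
      have hE' : ∀ j ∈ E ++ [i], j + 1 < n := by
        intro j hj
        rcases List.mem_append.1 hj with h | h
        · exact hE j h
        · rw [List.mem_singleton.1 h]
          exact hD i List.mem_cons_self
      have e1 : braidValue turnBack (Piece.cross i :: D) =
          crossing turnBack i * braidValue turnBack D := rfl
      have e2 : ((E ++ [i]).map turnBack).prod = (E.map turnBack).prod * turnBack i := by simp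
      have e3 : (E.map turnBack).prod * (crossing turnBack i * braidValue turnBack D) =
          AK • ((E.map turnBack).prod * braidValue turnBack D) +
          AK⁻¹ • ((E.map turnBack).prod * turnBack i * braidValue turnBack D) := by
        simp only [crossing, add_mul, mul_add, smul_mul_assoc, mul_smul_comm, one_mul, mul_assoc]
      rw [resolve, eval_add, eval_smul, eval_smul, map_add, smul_eq_mul, smul_eq_mul, map_mul,
        map_mul, ih hD' hE, ih hD' hE', hA, hA1, e1, e2, e3, map_add, map_smul, map_smul,
        smul_eq_mul, smul_eq_mul]
      ring
    | curl i =>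
      have e1 : braidValue turnBack (Piece.curl i :: D) =
          (-AK ^ 3) • braidValue turnBack D := by
        have : braidValue turnBack (Piece.curl i :: D) =
          ((-AK ^ 3) • 1) * braidValue turnBack D := rfl
        rw [this, smul_mul_assoc, one_mul]
      rw [resolve, eval_add, eval_smul, eval_smul, eval_smul, map_add, smul_eq_mul, smul_eq_mul,
        smul_eq_mul, map_mul, map_mul, map_mul, ih hD' hE, hA, hA1, e1, mul_smul_comm, map_smul,
        smul_eq_mul, show algebraMap Ground K circleValue = delta from rfl]
      have h : AK * delta + AK⁻¹ = -AK ^ 3 := by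
        rw [delta_eq]
        have := AK_ne_zero
        field_simp
        ring
      rw [← h]
      ring

theorem algebraMap_bracket {n : ℕ} {D : List Piece} (hD : Fits n D) :
    algebraMap Ground K (bracket n D) =
      delta ^ n * markovTrace (braidValue turnBack D) := by
  have h := eval_resolve hD (E := []) (by simp)
  rwa [List.map_nil, List.prod_nil, one_mul] at h

/-! ### Quantum integers -/

theorem aK_ne_zero : aK ≠ 0 := pow_ne_zero _ AK_ne_zero

theorem aK_pow_ne_one {n : ℕ} (hn : n ≠ 0) : aK ^ n ≠ 1 := by
  rw [aK, ← pow_mul]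
  exact AK_pow_ne_one (by omega)

theorem aK_pow_sub_inv_ne_zero {n : ℕ} (hn : n ≠ 0) : aK ^ n - (aK ^ n)⁻¹ ≠ 0 := by
  intro h
  have h0 := pow_ne_zero n aK_ne_zero
  apply aK_pow_ne_one (n := n + n) (by omega)
  rw [sub_eq_zero] at h
  rw [pow_add]
  nth_rewrite 2 [h]
  exact mul_inv_cancel₀ h0

theorem aK_sub_inv_ne_zero : aK - aK⁻¹ ≠ 0 := by
  simpa using aK_pow_sub_inv_ne_zero one_ne_zero

theorem qInt_zero : qInt 0 = 0 := by simp [qInt]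

theorem qInt_one : qInt 1 = 1 := by
  rw [qInt, pow_one, div_self aK_sub_inv_ne_zero]

theorem qInt_ne_zero {n : ℕ} (hn : n ≠ 0) : qInt n ≠ 0 :=
  div_ne_zero (aK_pow_sub_inv_ne_zero hn) aK_sub_inv_ne_zero

theorem delta_eq_aK : delta = -aK - aK⁻¹ := delta_eq

theorem qInt_add_two (n : ℕ) : qInt (n + 2) = -delta * qInt (n + 1) - qInt n := by
  have h := aK_sub_inv_ne_zero
  have h0 := aK_ne_zero
  rw [delta_eq_aK, qInt, qInt, qInt]
  rw [← mul_div_assoc, ← sub_div, div_left_inj' h]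
  field_simp
  ring

section Abstract

variable {B : Type*} [Ring B] [Algebra K B] {E : ℕ → B}

/-! ### Braid relations -/

theorem mem_strands {i n : ℕ} (h : i + 1 < n) : E i ∈ strands E n :=
  Algebra.subset_adjoin ⟨i, h, rfl⟩

theorem strands_mono {m n : ℕ} (h : m ≤ n) : strands E m ≤ strands E n :=
  Algebra.adjoin_mono fun _ ⟨i, hi, hx⟩ => ⟨i, hi.trans_le h, hx⟩

theorem crossing_mem_strands {i n : ℕ} (h : i + 1 < n) : crossing E i ∈ strands E n :=
  add_mem (Subalgebra.smul_mem _ (one_mem _) _) (Subalgebra.smul_mem _ (mem_strands h) _)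

theorem commute_of_mem_strands {n : ℕ} {x y : B} (hx : x ∈ strands E n)
    (h : ∀ i, i + 1 < n → Commute (E i) y) : Commute x y := by
  rw [strands] at hx
  induction hx using Algebra.adjoin_induction with
  | mem x hx =>
    obtain ⟨i, hi, rfl⟩ := hx
    exact h i hi
  | algebraMap r => exact Algebra.commutes r y
  | add x z _ _ hx hz => exact hx.add_left hz
  | mul x z _ _ hx hz => exact hx.mul_left hz

theorem commute_crossing {i : ℕ} {x : B} (h : Commute x (E i)) : Commute x (crossing E i) :=
  ((Commute.one_right x).smul_right _).add_right (h.smul_right _)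

namespace IsTL

theorem shift (hE : IsTL E) (m : ℕ) : IsTL fun i => E (m + i) where
  sq i := hE.sq _
  up i := hE.up _
  down i := hE.down _
  comm h := hE.comm (by omega)

theorem commute_strands (hE : IsTL E) {n j : ℕ} {x : B} (hx : x ∈ strands E n) (h : n ≤ j) :
    Commute x (E j) :=
  commute_of_mem_strands hx fun _ hi => hE.comm (by omega)

theorem commute_strands_crossing (hE : IsTL E) {n j : ℕ} {x : B} (hx : x ∈ strands E n)
    (h : n ≤ j) : Commute x (crossing E j) :=
  commute_crossing (hE.commute_strands hx h)

theorem crossing_mul_self (hE : IsTL E) (i : ℕ) : crossing E i * E i = (-(AK ^ 3)⁻¹) • E i := by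
  have h := AK_ne_zero
  rw [crossing, add_mul, smul_mul_assoc, smul_mul_assoc, one_mul, hE.sq, smul_smul, ← add_smul]
  congr 1
  rw [delta_eq]
  field_simp
  ring

theorem self_mul_crossing (hE : IsTL E) (i : ℕ) : E i * crossing E i = (-(AK ^ 3)⁻¹) • E i := by
  rw [← hE.crossing_mul_self]
  exact commute_crossing (Commute.refl _)

/-- After expansion the multiples of `x` have total coefficient A² + δ + A⁻² = 0. Stating this for
two elements makes both slide directions instances, and the opposite ring supplies the mirror
images. -/
theorem crossing_mul_crossing_mul {x y : B} (hx : x * x = delta • x) (hxy : x * y * x = x) :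
    (AK • 1 + AK⁻¹ • x) * (AK • 1 + AK⁻¹ • y) * x = y * x := by
  have h := AK_ne_zero
  have e : (AK • 1 + AK⁻¹ • x) * (AK • 1 + AK⁻¹ • y) * x =
      (AK * AK) • x + (AK⁻¹ * AK) • (y * x) + (AK * AK⁻¹) • (x * x) +
        (AK⁻¹ * AK⁻¹) • (x * y * x) := by
    simp only [add_mul, mul_add, smul_mul_assoc, mul_smul_comm, one_mul, mul_one, smul_smul,
      mul_assoc, smul_add]
    abel
  rw [e, hx, hxy, smul_smul, mul_inv_cancel₀ h, inv_mul_cancel₀ h, one_mul, one_smul,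
    delta_eq]
  have e2 : AK * AK + (-AK ^ 2 - (AK ^ 2)⁻¹) + AK⁻¹ * AK⁻¹ = 0 := by
    field_simp
    ring
  have e3 : (AK * AK) • x + y * x + (-AK ^ 2 - (AK ^ 2)⁻¹) • x + (AK⁻¹ * AK⁻¹) • x =
      (AK * AK + (-AK ^ 2 - (AK ^ 2)⁻¹) + AK⁻¹ * AK⁻¹) • x + y * x := by
    simp only [add_smul]
    abel
  rw [e3, e2, zero_smul, zero_add]

theorem mul_crossing_mul_crossing {x y : B} (hx : x * x = delta • x) (hxy : x * y * x = x) :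
    x * ((AK • 1 + AK⁻¹ • y) * (AK • 1 + AK⁻¹ • x)) = x * y := by
  have hx' : MulOpposite.op x * MulOpposite.op x = delta • MulOpposite.op x := by
    rw [← MulOpposite.op_mul, hx, MulOpposite.op_smul]
  have hxy' : MulOpposite.op x * MulOpposite.op y * MulOpposite.op x = MulOpposite.op x := by
    rw [← MulOpposite.op_mul, ← MulOpposite.op_mul, ← mul_assoc, hxy]
  have := congrArg MulOpposite.unop (crossing_mul_crossing_mul hx' hxy')
  simpa using this

/-- A turn-back slides along two crossings. -/
theorem slide_up (hE : IsTL E) (i : ℕ) :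
    crossing E i * crossing E (i + 1) * E i = E (i + 1) * E i :=
  crossing_mul_crossing_mul (hE.sq i) (hE.up i)

theorem slide_down (hE : IsTL E) (i : ℕ) :
    crossing E (i + 1) * crossing E i * E (i + 1) = E i * E (i + 1) :=
  crossing_mul_crossing_mul (hE.sq (i + 1)) (hE.down i)

theorem slide_up' (hE : IsTL E) (i : ℕ) :
    E (i + 1) * (crossing E i * crossing E (i + 1)) = E (i + 1) * E i :=
  mul_crossing_mul_crossing (hE.sq (i + 1)) (hE.down i)

theorem slide_down' (hE : IsTL E) (i : ℕ) :
    E i * (crossing E (i + 1) * crossing E i) = E i * E (i + 1) :=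
  mul_crossing_mul_crossing (hE.sq i) (hE.up i)

theorem semiconj_up (hE : IsTL E) (i : ℕ) :
    SemiconjBy (crossing E i * crossing E (i + 1)) (E i) (E (i + 1)) :=
  (hE.slide_up i).trans (hE.slide_up' i).symm

theorem semiconj_down (hE : IsTL E) (i : ℕ) :
    SemiconjBy (crossing E (i + 1) * crossing E i) (E (i + 1)) (E i) :=
  (hE.slide_down i).trans (hE.slide_down' i).symm

/-- A crossing is a combination of 1 and a turn-back, so it inherits the semiconjugacy of
turn-backs. -/
theorem braid (hE : IsTL E) (i : ℕ) :
    crossing E i * crossing E (i + 1) * crossing E i =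
      crossing E (i + 1) * crossing E i * crossing E (i + 1) := by
  rw [mul_assoc (crossing E (i + 1))]
  exact ((SemiconjBy.one_right _).smul_right _).add_right ((hE.semiconj_up i).smul_right _)

end IsTL

/-! ### The braids of the Hopf cable and of the full twist -/

/-- The crossings `i, i + 1, …, i + n - 1`. -/
def ascend (E : ℕ → B) (i : ℕ) : ℕ → B
  | 0 => 1
  | n + 1 => ascend E i n * crossing E (i + n)

/-- The crossings `i + n - 1, …, i + 1, i`. -/
def descend (E : ℕ → B) (i : ℕ) : ℕ → B
  | 0 => 1
  | n + 1 => crossing E (i + n) * descend E i n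

/-- The strand in position `i + n` runs once around the `n` strands to its left. -/
def around (E : ℕ → B) (i n : ℕ) : B := descend E i n * ascend E i n

/-- A block of `m` strands passes across a block of `n` strands. -/
def block (E : ℕ → B) : ℕ → ℕ → B
  | 0, _ => 1
  | m + 1, n => ascend E m n * block E m n

/-- The full twist. -/
def twistValue (E : ℕ → B) : ℕ → B
  | 0 => 1
  | n + 1 => twistValue E n * around E 0 n

theorem braidValue_passRight (i n : ℕ) : braidValue E (passRight i n) = ascend E i n := by
  induction n with
  | zero => simp [passRight, braidValue, ascend]
  | succ n ih =>
    rw [passRight, List.range_succ, List.map_append, braidValue_append, ← passRight, ih, ascend]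
    simp [braidValue, pieceValue]

theorem braidValue_blockCross (m n : ℕ) : braidValue E (blockCross m n) = block E m n := by
  induction m with
  | zero => simp [blockCross, braidValue, block]
  | succ m ih =>
    rw [blockCross, List.range_succ, List.reverse_append, List.map_append, List.flatten_append,
      braidValue_append, ← blockCross, ih, block, ← braidValue_passRight]
    simp

theorem braidValue_runAround (n : ℕ) : braidValue E (runAround n) = around E 0 n := by
  have h : braidValue E ((List.range n).reverse.map Piece.cross) = descend E 0 n := by
    induction n with
    | zero => simp [braidValue, descend]
    | succ n ih =>
      rw [List.range_succ, List.reverse_append, List.map_append, braidValue_append, ih, descend,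
        zero_add]
      simp [braidValue, pieceValue]
  rw [runAround, braidValue_append, h, around, ← braidValue_passRight]
  simp [passRight]

theorem braidValue_fullTwist (n : ℕ) : braidValue E (fullTwist n) = twistValue E n := by
  induction n with
  | zero => simp [fullTwist, braidValue, twistValue]
  | succ n ih => rw [fullTwist, braidValue_append, ih, braidValue_runAround, twistValue]

theorem braidValue_twistedCable (n : ℕ) :
    braidValue E (twistedCable n) = (-AK ^ 3) ^ n • twistValue E n := by
  have h : braidValue E ((List.range n).map Piece.curl) = (-AK ^ 3) ^ n • 1 := by
    rw [← one_pow (M := B) n, ← _root_.smul_pow]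
    simp [braidValue, Function.comp_def, pieceValue]
  rw [twistedCable, braidValue_append, braidValue_fullTwist, h, mul_smul_comm, mul_one]

theorem ascend_mem (i n : ℕ) : ascend E i n ∈ strands E (i + n + 1) := by
  induction n with
  | zero => exact one_mem _
  | succ n ih => exact mul_mem (strands_mono (by omega) ih) (crossing_mem_strands (by omega))

theorem descend_mem (i n : ℕ) : descend E i n ∈ strands E (i + n + 1) := by
  induction n with
  | zero => exact one_mem _
  | succ n ih => exact mul_mem (crossing_mem_strands (by omega)) (strands_mono (by omega) ih)

theorem around_mem (i n : ℕ) : around E i n ∈ strands E (i + n + 1) :=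
  mul_mem (descend_mem i n) (ascend_mem i n)

theorem block_mem (m n : ℕ) : block E m n ∈ strands E (m + n) := by
  induction m with
  | zero => exact one_mem _
  | succ m ih =>
    exact mul_mem (strands_mono (by omega) (ascend_mem m n)) (strands_mono (by omega) ih)

theorem twistValue_mem (n : ℕ) : twistValue E n ∈ strands E n := by
  induction n with
  | zero => exact one_mem _
  | succ n ih =>
    exact mul_mem (strands_mono (by omega) ih) (strands_mono (by omega) (around_mem 0 n))

theorem ascend_shift (m i n : ℕ) : ascend (fun j => E (m + j)) i n = ascend E (m + i) n := by
  induction n with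
  | zero => rfl
  | succ n ih => rw [ascend, ascend, ih, crossing, crossing, add_assoc]

theorem descend_shift (m i n : ℕ) : descend (fun j => E (m + j)) i n = descend E (m + i) n := by
  induction n with
  | zero => rfl
  | succ n ih => rw [descend, descend, ih, crossing, crossing, add_assoc]

theorem around_shift (m i n : ℕ) : around (fun j => E (m + j)) i n = around E (m + i) n := by
  rw [around, around, ascend_shift, descend_shift]

theorem around_succ (i n : ℕ) :
    around E i (n + 1) = crossing E (i + n) * around E i n * crossing E (i + n) := by
  simp only [around, ascend, descend, mul_assoc]

namespace IsTL

/-- `block` grows by strands of the first block; this is the recursion in the second block, obtained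
by commuting distant crossings. -/
theorem block_succ_right (hE : IsTL E) (m n : ℕ) :
    block E m (n + 1) = block E m n * descend E n m := by
  induction m with
  | zero => simp [block, descend]
  | succ m ih =>
    have h := (hE.commute_strands_crossing (block_mem m n) le_rfl).eq
    rw [block, block, ih, ascend, descend, add_comm n m]
    simp only [mul_assoc]
    rw [← mul_assoc (crossing E (m + n)), ← h, mul_assoc]

theorem semiconj_descend (hE : IsTL E) (n : ℕ) {m i : ℕ} (h : i + 1 < m) :
    SemiconjBy (descend E n m) (E (n + i + 1)) (E (n + i)) := by
  induction m with
  | zero => omega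
  | succ m ih =>
    rcases Nat.lt_or_ge (i + 1) m with h' | h'
    · exact SemiconjBy.mul_left
        (commute_crossing (E := E) (hE.comm (show n + i + 2 ≤ n + m by omega))).symm (ih h')
    · obtain rfl : m = i + 1 := by omega
      rw [descend, descend, ← mul_assoc]
      exact SemiconjBy.mul_left (hE.semiconj_down (n + i))
        (hE.commute_strands (descend_mem n i) le_rfl)

theorem semiconj_ascend (hE : IsTL E) (m : ℕ) {n i : ℕ} (h : i + 1 < n) :
    SemiconjBy (ascend E m n) (E (m + i)) (E (m + i + 1)) := by
  induction n with
  | zero => omega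
  | succ n ih =>
    rcases Nat.lt_or_ge (i + 1) n with h' | h'
    · exact SemiconjBy.mul_left (ih h')
        (commute_crossing (E := E) (hE.comm (show m + i + 2 ≤ m + n by omega))).symm
    · obtain rfl : n = i + 1 := by omega
      rw [ascend, ascend, mul_assoc]
      exact SemiconjBy.mul_left (hE.commute_strands (ascend_mem m i) le_rfl)
        (hE.semiconj_up (m + i))

/-- Turn-backs of the first block slide through the crossing of two blocks. -/
theorem semiconj_block_left (hE : IsTL E) {m i : ℕ} (n : ℕ) (h : i + 1 < m) :
    SemiconjBy (block E m n) (E (n + i)) (E i) := by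
  induction n with
  | zero =>
    have : block E m 0 = 1 := by
      clear h
      induction m with
      | zero => rfl
      | succ m ih => rw [block, ih, ascend, mul_one]
    rw [this, zero_add]
    exact SemiconjBy.one_left _
  | succ n ih =>
    rw [hE.block_succ_right]
    refine SemiconjBy.mul_left ih ?_
    rw [add_right_comm]
    exact hE.semiconj_descend n h

/-- Turn-backs of the second block slide through the crossing of two blocks. -/
theorem semiconj_block_right (hE : IsTL E) (m : ℕ) {n i : ℕ} (h : i + 1 < n) :
    SemiconjBy (block E m n) (E i) (E (m + i)) := by
  induction m with
  | zero =>
    rw [zero_add]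
    exact SemiconjBy.one_left _
  | succ m ih =>
    rw [add_right_comm]
    exact SemiconjBy.mul_left (hE.semiconj_ascend m h) ih

/-- A cap slides across a block of strands and back. -/
theorem cap_around_block (hE : IsTL E) (n m : ℕ) :
    E (n + m) * (descend E n m * descend E (n + 1) m * (ascend E (n + 1) m * ascend E n m)) =
      E (n + m) := by
  induction m with
  | zero => simp [descend, ascend]
  | succ m ih =>
    have h1 := (hE.commute_strands_crossing (descend_mem n m) (le_refl (n + m + 1))).eq
    have h2 := (hE.commute_strands_crossing (ascend_mem n m) (le_refl (n + m + 1))).eq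
    have e1 : descend E n (m + 1) * descend E (n + 1) (m + 1) =
        crossing E (n + m) * crossing E (n + m + 1) * (descend E n m * descend E (n + 1) m) := by
      rw [descend, descend, add_right_comm n 1 m]
      simp only [mul_assoc]
      rw [← mul_assoc (descend E n m), h1, mul_assoc]
    have e2 : ascend E (n + 1) (m + 1) * ascend E n (m + 1) =
        (ascend E (n + 1) m * ascend E n m) * (crossing E (n + m + 1) * crossing E (n + m)) := by
      rw [ascend, ascend, add_right_comm n 1 m]
      simp only [mul_assoc]
      rw [← mul_assoc (ascend E n m), h2, mul_assoc]
    -- The outermost crossings carry the cap from `n + m + 1` to `n + m`, where the induction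
    -- hypothesis applies, and then carry it back.
    calc _ = E (n + m + 1) * (crossing E (n + m) * crossing E (n + m + 1)) *
          ((descend E n m * descend E (n + 1) m) * (ascend E (n + 1) m * ascend E n m)) *
          (crossing E (n + m + 1) * crossing E (n + m)) := by
          rw [e1, e2]
          simp only [mul_assoc, add_assoc]
      _ = E (n + m + 1) * (E (n + m) *
          ((descend E n m * descend E (n + 1) m) * (ascend E (n + 1) m * ascend E n m))) *
          (crossing E (n + m + 1) * crossing E (n + m)) := by
          rw [hE.slide_up']
          simp only [mul_assoc]
      _ = E (n + m + 1) := by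
          rw [ih, mul_assoc, hE.slide_down', ← mul_assoc, hE.down]

/-- The strand around a cabled cap slides off. -/
theorem cap_block (hE : IsTL E) (m n : ℕ) :
    E (m + n) * (block E m (n + 2) * block E (n + 2) m) =
      E (m + n) * (block E m n * block E n m) := by
  have h := (hE.commute_strands (block_mem m n) le_rfl).eq
  calc _ = E (m + n) * block E m n * (descend E n m * descend E (n + 1) m *
        (ascend E (n + 1) m * ascend E n m)) * block E n m := by
        rw [hE.block_succ_right, hE.block_succ_right, block, block]
        simp only [mul_assoc]
    _ = _ := by
        rw [← h, mul_assoc (block E m n), add_comm m n, hE.cap_around_block, add_comm n m, h,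
          mul_assoc]

/-! ### The full twist -/

theorem commute_around (hE : IsTL E) {n i : ℕ} (h : i + 1 < n) :
    Commute (E i) (around E 0 n) := by
  have h1 := hE.semiconj_ascend 0 h
  have h2 := hE.semiconj_descend 0 h
  rw [zero_add] at h1 h2
  exact (h2.mul_left h1).symm

/-- By `twistValue_add_two` this is the essential part of a full twist acting on two strands joined
by a turn-back: they slip off the other strands and only a curl remains. The braid relation moves
the turn-back one position down for the induction. -/
theorem around_crossing_around_mul (hE : IsTL E) (n : ℕ) :
    around E 0 n * crossing E n * around E 0 n * E n = (-(AK ^ 3)⁻¹) • E n := by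
  induction n with
  | zero => simp [around, ascend, descend, hE.crossing_mul_self]
  | succ n ih =>
    have h1 := (hE.commute_strands_crossing (around_mem 0 n) (by omega : 0 + n + 1 ≤ n + 1)).eq
    have h2 : ∀ y, around E 0 n * (crossing E (n + 1) * y) =
        crossing E (n + 1) * (around E 0 n * y) := fun y => by rw [← mul_assoc, h1, mul_assoc]
    rw [around_succ, zero_add]
    calc _ = crossing E n * around E 0 n * (crossing E n * crossing E (n + 1) * crossing E n) *
          around E 0 n * (crossing E n * E (n + 1)) := by simp only [mul_assoc]
      _ = crossing E n * (around E 0 n * crossing E (n + 1)) * crossing E n *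
          (crossing E (n + 1) * around E 0 n) * (crossing E n * E (n + 1)) := by
          rw [hE.braid]
          simp only [mul_assoc]
      _ = crossing E n * crossing E (n + 1) * (around E 0 n * crossing E n * around E 0 n) *
          (crossing E (n + 1) * crossing E n * E (n + 1)) := by
          simp only [mul_assoc, h2]
      _ = crossing E n * crossing E (n + 1) *
          (around E 0 n * crossing E n * around E 0 n * E n) * E (n + 1) := by
          rw [hE.slide_down]
          simp only [mul_assoc]
      _ = _ := by
          rw [ih, mul_smul_comm, hE.slide_up, smul_mul_assoc, hE.down]

theorem mul_around_crossing_around (hE : IsTL E) (n : ℕ) :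
    E n * (around E 0 n * crossing E n * around E 0 n) = (-(AK ^ 3)⁻¹) • E n := by
  induction n with
  | zero => simp [around, ascend, descend, hE.self_mul_crossing]
  | succ n ih =>
    have h1 := (hE.commute_strands_crossing (around_mem 0 n) (by omega : 0 + n + 1 ≤ n + 1)).eq
    have h2 : ∀ y, around E 0 n * (crossing E (n + 1) * y) =
        crossing E (n + 1) * (around E 0 n * y) := fun y => by rw [← mul_assoc, h1, mul_assoc]
    rw [around_succ, zero_add]
    calc _ = E (n + 1) * crossing E n * around E 0 n *
          (crossing E n * crossing E (n + 1) * crossing E n) *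
          around E 0 n * crossing E n := by simp only [mul_assoc]
      _ = E (n + 1) * crossing E n * (around E 0 n * crossing E (n + 1)) * crossing E n *
          (crossing E (n + 1) * around E 0 n) * crossing E n := by
          rw [hE.braid]
          simp only [mul_assoc]
      _ = E (n + 1) * (crossing E n * crossing E (n + 1)) *
          (around E 0 n * crossing E n * around E 0 n) * (crossing E (n + 1) * crossing E n) := by
          simp only [mul_assoc, h2]
      _ = E (n + 1) * (E n * (around E 0 n * crossing E n * around E 0 n)) *
          (crossing E (n + 1) * crossing E n) := by
          rw [hE.slide_up']
          simp only [mul_assoc]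
      _ = _ := by
          rw [ih, mul_smul_comm, smul_mul_assoc, mul_assoc, hE.slide_down', ← mul_assoc, hE.down]

theorem twistValue_add_two (n : ℕ) : twistValue E (n + 2) =
    twistValue E n * (around E 0 n * crossing E n * around E 0 n * crossing E n) := by
  rw [twistValue, twistValue, around_succ, zero_add]
  simp only [mul_assoc]

/-- A full twist on a cap is undone. -/
theorem twistValue_mul_cap (hE : IsTL E) (n : ℕ) :
    twistValue E (n + 2) * E n = (AK ^ 6)⁻¹ • (twistValue E n * E n) := by
  have h := AK_ne_zero
  rw [twistValue_add_two, mul_assoc, mul_assoc _ (crossing E n), hE.crossing_mul_self,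
    mul_smul_comm, hE.around_crossing_around_mul, smul_smul, mul_smul_comm]
  congr 1
  field_simp

/-- The full twist is central. -/
theorem commute_twistValue (hE : IsTL E) {n i : ℕ} (h : i + 1 < n) :
    Commute (E i) (twistValue E n) := by
  induction n with
  | zero => omega
  | succ n ih =>
    rcases Nat.lt_or_ge (i + 1) n with h' | h'
    · exact (ih h').mul_right (hE.commute_around h')
    · obtain rfl : n = i + 1 := by omega
      rw [show i + 1 + 1 = i + 2 from rfl, twistValue_add_two]
      refine (hE.commute_strands (twistValue_mem i) le_rfl).symm.mul_right ?_
      refine Commute.mul_right ?_ (commute_crossing (Commute.refl _))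
      -- Left and right multiplication by the last turn-back give the same multiple of it.
      exact (hE.mul_around_crossing_around i).trans (hE.around_crossing_around_mul i).symm

end IsTL

end Abstract

section Abstract

variable {B : Type*} [Ring B] [Algebra K B] {E : ℕ → B}

/-! ### Jones–Wenzl idempotents -/

/-- The Jones–Wenzl idempotents, by Wenzl's recursion. -/
def jonesWenzl (E : ℕ → B) : ℕ → B
  | 0 => 1
  -- The sign is plus because a circle is worth -[2]. At `n = 0` the truncated index `n - 1` is
  -- harmless, its coefficient being [0]/[1] = 0.
  | n + 1 => jonesWenzl E n +
      (qInt n / qInt (n + 1)) • (jonesWenzl E n * E (n - 1) * jonesWenzl E n)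

theorem jonesWenzl_one : jonesWenzl E 1 = 1 := by
  simp [jonesWenzl, qInt_zero]

theorem jonesWenzl_mem (n : ℕ) : jonesWenzl E n ∈ strands E n := by
  induction n with
  | zero => exact one_mem _
  | succ n ih =>
    have ih' := strands_mono n.le_succ ih
    refine add_mem ih' ?_
    rcases Nat.eq_zero_or_pos n with rfl | hn
    · simp [qInt_zero]
    · exact Subalgebra.smul_mem _ (mul_mem (mul_mem ih' (mem_strands (by omega))) ih') _

theorem semiconj_jonesWenzl {E' : ℕ → B} {b : B} {n : ℕ}
    (h : ∀ i, i + 1 < n → SemiconjBy b (E i) (E' i)) :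
    SemiconjBy b (jonesWenzl E n) (jonesWenzl E' n) := by
  induction n with
  | zero => exact SemiconjBy.one_right _
  | succ n ih =>
    have ih' := ih fun i hi => h i (by omega)
    refine ih'.add_right ?_
    rcases Nat.eq_zero_or_pos n with rfl | hn
    · simp [qInt_zero]
    · exact ((ih'.mul_right (h _ (by omega))).mul_right ih').smul_right _

theorem delta_add_div (n : ℕ) :
    delta + qInt n / qInt (n + 1) = -(qInt (n + 2) / qInt (n + 1)) := by
  have h := qInt_ne_zero n.succ_ne_zero
  rw [qInt_add_two]
  field_simp
  ring

theorem jonesWenzl_mul_succ {n : ℕ} (h : jonesWenzl E n * jonesWenzl E n = jonesWenzl E n) :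
    jonesWenzl E n * jonesWenzl E (n + 1) = jonesWenzl E (n + 1) := by
  rw [jonesWenzl, mul_add, mul_smul_comm, ← mul_assoc, ← mul_assoc, h]

theorem jonesWenzl_succ_mul {n : ℕ} (h : jonesWenzl E n * jonesWenzl E n = jonesWenzl E n) :
    jonesWenzl E (n + 1) * jonesWenzl E n = jonesWenzl E (n + 1) := by
  rw [jonesWenzl, add_mul, smul_mul_assoc, mul_assoc _ (jonesWenzl E n) (jonesWenzl E n), h]

namespace IsTL

theorem commute_jonesWenzl (hE : IsTL E) (n : ℕ) : Commute (jonesWenzl E n) (E n) :=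
  hE.commute_strands (jonesWenzl_mem n) le_rfl

theorem cap_mul_cap (hE : IsTL E) {n : ℕ}
    (h : jonesWenzl E (n + 1) * jonesWenzl E (n + 1) = jonesWenzl E (n + 1)) :
    E (n + 1) * (jonesWenzl E (n + 1) * E n * jonesWenzl E (n + 1)) * E (n + 1) =
      jonesWenzl E (n + 1) * E (n + 1) := by
  have hc := (hE.commute_jonesWenzl (n + 1)).eq
  calc _ = (E (n + 1) * jonesWenzl E (n + 1)) * E n * (jonesWenzl E (n + 1) * E (n + 1)) := by
        simp only [mul_assoc]
    _ = jonesWenzl E (n + 1) * (E (n + 1) * E n * E (n + 1)) * jonesWenzl E (n + 1) := by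
        rw [← hc]
        nth_rewrite 2 [hc]
        simp only [mul_assoc]
    _ = _ := by
        rw [hE.down, mul_assoc, ← hc, ← mul_assoc, h]

/-- The partial closure of the last strand: the leading term contributes δ and the correction
[n]/[n+1]. Idempotency is assumed because `jonesWenzl_spec` uses this inside its induction. -/
theorem cap_jonesWenzl_cap_of_idem (hE : IsTL E) {n : ℕ}
    (h : jonesWenzl E n * jonesWenzl E n = jonesWenzl E n) :
    E n * jonesWenzl E (n + 1) * E n =
      (-(qInt (n + 2) / qInt (n + 1))) • (jonesWenzl E n * E n) := by
  have hc := (hE.commute_jonesWenzl n).eq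
  rw [← delta_add_div, jonesWenzl, mul_add, add_mul, ← hc, mul_assoc, hE.sq, mul_smul_comm,
    mul_smul_comm, smul_mul_assoc, add_smul]
  congr 1
  cases n with
  | zero => simp [qInt_zero]
  | succ n => rw [Nat.add_sub_cancel, hE.cap_mul_cap h]

/-- Wenzl's coefficient is the negative inverse of the partial closure scalar (`hs`), so the new
turn-back is annihilated. Idempotency follows, because the correction term of the second factor is
then killed by the first. -/
theorem jonesWenzl_spec (hE : IsTL E) (n : ℕ) :
    jonesWenzl E n * jonesWenzl E n = jonesWenzl E n ∧
      ∀ i, i + 1 < n → E i * jonesWenzl E n = 0 ∧ jonesWenzl E n * E i = 0 := by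
  induction n using Nat.twoStepInduction with
  | zero => exact ⟨by simp [jonesWenzl], fun i hi => by omega⟩
  | one => exact ⟨by simp [jonesWenzl_one], fun i hi => by omega⟩
  | more n ih1 ih2 =>
    have hcap := hE.cap_jonesWenzl_cap_of_idem ih1.1
    have hgf := jonesWenzl_mul_succ ih1.1
    have hfg := jonesWenzl_succ_mul ih1.1
    have hc := (hE.commute_jonesWenzl n).eq
    obtain ⟨hff, hkill⟩ := ih2
    have hdef : jonesWenzl E (n + 2) = jonesWenzl E (n + 1) + (qInt (n + 1) / qInt (n + 2)) •
        (jonesWenzl E (n + 1) * E n * jonesWenzl E (n + 1)) := rfl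
    have hs : qInt (n + 1) / qInt (n + 2) * -(qInt (n + 2) / qInt (n + 1)) = -1 := by
      have h1 := qInt_ne_zero n.succ_ne_zero
      have h2 := qInt_ne_zero (n + 1).succ_ne_zero
      field_simp
    have hl : E n * jonesWenzl E (n + 2) = 0 := by
      rw [hdef, mul_add, mul_smul_comm, ← mul_assoc, ← mul_assoc, hcap, smul_mul_assoc, smul_smul,
        hs, hc, mul_assoc, hgf, neg_one_smul, add_neg_cancel]
    have hr : jonesWenzl E (n + 2) * E n = 0 := by
      rw [hdef, add_mul, smul_mul_assoc, mul_assoc _ (jonesWenzl E (n + 1)), mul_assoc _ (E n),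
        ← mul_assoc (E n), hcap, mul_smul_comm, smul_smul, hs, ← mul_assoc, hfg, neg_one_smul,
        add_neg_cancel]
    refine ⟨?_, fun i hi => ?_⟩
    · nth_rewrite 2 [hdef]
      rw [mul_add, mul_smul_comm, ← mul_assoc, ← mul_assoc, jonesWenzl_succ_mul hff, hr, zero_mul,
        smul_zero, add_zero]
    · rcases Nat.lt_or_ge (i + 1) (n + 1) with h | h
      · obtain ⟨h1, h2⟩ := hkill i h
        constructor
        · rw [hdef, mul_add, mul_smul_comm, ← mul_assoc, ← mul_assoc, h1]
          simp
        · rw [hdef, add_mul, smul_mul_assoc, mul_assoc _ _ (E i), h2]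
          simp
      · obtain rfl : i = n := by omega
        exact ⟨hl, hr⟩

theorem jonesWenzl_idem (hE : IsTL E) (n : ℕ) :
    jonesWenzl E n * jonesWenzl E n = jonesWenzl E n := (hE.jonesWenzl_spec n).1

theorem cap_jonesWenzl_cap (hE : IsTL E) (n : ℕ) :
    E n * jonesWenzl E (n + 1) * E n =
      (-(qInt (n + 2) / qInt (n + 1))) • (jonesWenzl E n * E n) :=
  hE.cap_jonesWenzl_cap_of_idem (hE.jonesWenzl_idem n)

theorem commute_strands_jonesWenzl (hE : IsTL E) {n : ℕ} {x : B} (hx : x ∈ strands E n) :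
    Commute x (jonesWenzl E n) :=
  commute_of_mem_strands hx fun i hi => by
    obtain ⟨h1, h2⟩ := (hE.jonesWenzl_spec n).2 i hi
    exact h1.trans h2.symm

theorem crossing_mul_jonesWenzl (hE : IsTL E) {i n : ℕ} (h : i + 1 < n) :
    crossing E i * jonesWenzl E n = AK • jonesWenzl E n := by
  rw [crossing, add_mul, smul_mul_assoc, smul_mul_assoc, ((hE.jonesWenzl_spec n).2 i h).1, one_mul,
    smul_zero, add_zero]

theorem around_mul_jonesWenzl (hE : IsTL E) {n N : ℕ} (h : n + 1 ≤ N) :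
    around E 0 n * jonesWenzl E N = AK ^ (2 * n) • jonesWenzl E N := by
  induction n with
  | zero => simp [around, ascend, descend]
  | succ n ih =>
    rw [around_succ, zero_add, mul_assoc, hE.crossing_mul_jonesWenzl (by omega), mul_smul_comm,
      mul_assoc, ih (by omega), mul_smul_comm, hE.crossing_mul_jonesWenzl (by omega), smul_smul,
      smul_smul]
    congr 1
    ring

theorem AK_pow_succ_mul (n : ℕ) :
    AK ^ ((n + 1) * (n + 1 - 1)) = AK ^ (n * (n - 1)) * AK ^ (2 * n) := by
  rw [← pow_add]
  congr 1
  cases n with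
  | zero => rfl
  | succ n =>
    simp only [Nat.add_sub_cancel]
    ring

theorem twistValue_mul_jonesWenzl (hE : IsTL E) {n N : ℕ} (h : n ≤ N) :
    twistValue E n * jonesWenzl E N = AK ^ (n * (n - 1)) • jonesWenzl E N := by
  induction n with
  | zero => simp [twistValue]
  | succ n ih =>
    rw [twistValue, mul_assoc, hE.around_mul_jonesWenzl h, mul_smul_comm, ih (by omega), smul_smul,
      AK_pow_succ_mul, mul_comm]

theorem commute_twistValue_strands (hE : IsTL E) {n : ℕ} {x : B} (hx : x ∈ strands E n) :
    Commute x (twistValue E n) :=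
  commute_of_mem_strands hx fun _ hi => hE.commute_twistValue hi

/-- The comparison of scalars that ends `cap_around_jonesWenzl`, with the common factor A^{k(k-1)}
removed. -/
theorem lam_relation (k : ℕ) :
    AK ^ (2 * k) * (-aK ^ (k + 2) - (aK ^ (k + 2))⁻¹) =
      AK ^ (4 * k + 2) * -(qInt (k + 3) / qInt (k + 2)) -
        qInt (k + 1) / qInt (k + 2) * (AK ^ 6)⁻¹ := by
  have h0 := aK_ne_zero
  have h1 := aK_sub_inv_ne_zero
  have h2 : aK ^ (k + 2) - (aK ^ (k + 2))⁻¹ ≠ 0 := aK_pow_sub_inv_ne_zero (by omega)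
  have e1 : AK ^ (2 * k) = aK ^ k := by rw [aK, ← pow_mul]
  have e2 : AK ^ (4 * k + 2) = aK ^ (2 * k + 1) := by
    rw [aK, ← pow_mul]
    congr 1
    ring
  have e3 : AK ^ 6 = aK ^ 3 := by rw [aK, ← pow_mul]
  rw [e1, e2, e3]
  have e4 : ∀ m, qInt m / qInt (k + 2) =
      (aK ^ m - (aK ^ m)⁻¹) / (aK ^ (k + 2) - (aK ^ (k + 2))⁻¹) := by
    intro m
    rw [qInt, qInt, div_div_div_cancel_right₀ h1]
  rw [e4, e4, ← mul_left_inj' h2]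
  have e5 : (aK ^ (2 * k + 1) *
      -((aK ^ (k + 3) - (aK ^ (k + 3))⁻¹) / (aK ^ (k + 2) - (aK ^ (k + 2))⁻¹)) -
      (aK ^ (k + 1) - (aK ^ (k + 1))⁻¹) / (aK ^ (k + 2) - (aK ^ (k + 2))⁻¹) * (aK ^ 3)⁻¹) *
      (aK ^ (k + 2) - (aK ^ (k + 2))⁻¹) =
      -aK ^ (2 * k + 1) * (aK ^ (k + 3) - (aK ^ (k + 3))⁻¹) -
        (aK ^ (k + 1) - (aK ^ (k + 1))⁻¹) * (aK ^ 3)⁻¹ := by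
    generalize aK ^ (k + 2) - (aK ^ (k + 2))⁻¹ = y at h2
    field_simp
  rw [e5]
  field_simp
  ring

/-- A strand around a Jones–Wenzl idempotent may be removed. -/
theorem cap_around_jonesWenzl (hE : IsTL E) (n : ℕ) :
    E n * (jonesWenzl E n * around E 0 n) * E n =
      (-aK ^ (n + 1) - (aK ^ (n + 1))⁻¹) • (jonesWenzl E n * E n) := by
  cases n with
  | zero =>
    simp only [jonesWenzl, around, ascend, descend, mul_one, one_mul, hE.sq, zero_add, pow_one,
      delta_eq_aK]
  | succ k =>
    set f := jonesWenzl E (k + 1) with hf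
    have hmem : f ∈ strands E (k + 1) := jonesWenzl_mem _
    have hidem := hE.jonesWenzl_idem (k + 1)
    have hdef : jonesWenzl E (k + 2) =
        f + (qInt (k + 1) / qInt (k + 2)) • (f * E k * f) := rfl
    have hfT : ∀ j ≤ k + 1, f * twistValue E j = AK ^ (j * (j - 1)) • f := by
      intro j hj
      rw [← hE.twistValue_mul_jonesWenzl hj]
      exact (hE.commute_strands_jonesWenzl (strands_mono hj (twistValue_mem j))).symm
    -- The product of `f` with the twist on `k + 2` strands is computed twice. In `e1` the
    -- idempotent absorbs the twist on `k + 1` strands, leaving the encircling strand. In `e2` it is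
    -- split by Wenzl's recursion: the twist is scalar on the larger idempotent and is undone on the
    -- cap term. Closing the last strand in both gives the encircling scalar.
    have e1 : f * twistValue E (k + 2) =
        AK ^ ((k + 1) * (k + 1 - 1)) • (f * around E 0 (k + 1)) := by
      rw [twistValue, ← mul_assoc, hfT _ le_rfl, smul_mul_assoc]
    have e2 : f * twistValue E (k + 2) = AK ^ ((k + 2) * (k + 2 - 1)) • jonesWenzl E (k + 2) -
        (qInt (k + 1) / qInt (k + 2) * (AK ^ 6)⁻¹ * AK ^ (k * (k - 1))) • (f * E k * f) := by
      have h1 : f = jonesWenzl E (k + 2) - (qInt (k + 1) / qInt (k + 2)) • (f * E k * f) := by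
        rw [hdef, add_sub_cancel_right]
      have h2 : twistValue E (k + 2) * (f * E k * f) =
          ((AK ^ 6)⁻¹ * AK ^ (k * (k - 1))) • (f * E k * f) := by
        have h3 := (hE.commute_twistValue_strands (strands_mono (show k + 1 ≤ k + 2 by omega) hmem)).eq
        rw [← mul_assoc, ← mul_assoc, ← h3, mul_assoc f, hE.twistValue_mul_cap, mul_smul_comm,
          ← mul_assoc, hfT k (by omega)]
        simp only [smul_mul_assoc, smul_smul]
      rw [(hE.commute_twistValue_strands (strands_mono (show k + 1 ≤ k + 2 by omega) hmem)).eq]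
      nth_rewrite 1 [h1]
      rw [mul_sub, hE.twistValue_mul_jonesWenzl le_rfl, mul_smul_comm, h2, smul_smul,
        mul_assoc (qInt (k + 1) / qInt (k + 2))]
    have e3 := congrArg (fun x => E (k + 1) * x * E (k + 1)) (e1.symm.trans e2)
    simp only [mul_sub, sub_mul, mul_smul_comm, smul_mul_assoc, hE.cap_jonesWenzl_cap] at e3
    rw [AK_pow_succ_mul (k + 1), AK_pow_succ_mul k, smul_smul, ← hf, hE.cap_mul_cap hidem,
      ← sub_smul] at e3
    have h0 : AK ^ (k * (k - 1)) * AK ^ (2 * k) ≠ 0 :=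
      mul_ne_zero (pow_ne_zero _ AK_ne_zero) (pow_ne_zero _ AK_ne_zero)
    refine smul_right_injective B h0 ?_
    simp only
    rw [e3, smul_smul]
    congr 1
    have h := lam_relation k
    simp only [add_assoc, Nat.reduceAdd] at h ⊢
    linear_combination -AK ^ (k * (k - 1)) * h

end IsTL

/-! ### Traces on the annulus -/

/-- Functionals on diagrams in the annulus: they are invariant under isotopy of closures. -/
structure IsAnnular (E : ℕ → B) (Φ : ℕ → B →ₗ[K] K) : Prop where
  mul_comm {n : ℕ} {x y : B} (hx : x ∈ strands E n) (hy : y ∈ strands E n) :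
    Φ n (x * y) = Φ n (y * x)
  cap {n : ℕ} {x : B} (hx : x ∈ strands E n) : Φ (n + 2) (x * E n) = delta * Φ n x

namespace IsAnnular

variable {Φ : ℕ → B →ₗ[K] K}

/-- Both sides equal δ times the closure of `x * E n * E (n + 1)`: expand a turn-back by `up` or
`down` and rotate. Hence a turn-back beside `x` can be moved to the end, where `cap` removes it. -/
theorem move_cap (hΦ : IsAnnular E Φ) (hE : IsTL E) {n N : ℕ} (hN : n + 2 < N) {x : B}
    (hx : x ∈ strands E n) : Φ N (x * E n) = Φ N (x * E (n + 1)) := by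
  have hx' : x ∈ strands E N := strands_mono (by omega) hx
  have h0 : E n ∈ strands E N := mem_strands (by omega)
  have h1 : E (n + 1) ∈ strands E N := mem_strands (by omega)
  have c0 := (hE.commute_strands hx le_rfl).eq
  have c1 := (hE.commute_strands hx n.le_succ).eq
  have e1 : Φ N (x * E n) = delta * Φ N (x * E n * E (n + 1)) := by
    calc _ = Φ N ((x * E n * E (n + 1)) * E n) := by
          rw [mul_assoc, mul_assoc, ← mul_assoc (E n), hE.up]
      _ = Φ N (E n * (x * E n * E (n + 1))) := hΦ.mul_comm (mul_mem (mul_mem hx' h0) h1) h0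
      _ = Φ N (delta • (x * E n * E (n + 1))) := by
          rw [← mul_assoc, ← mul_assoc, ← c0, mul_assoc x, hE.sq, mul_smul_comm, smul_mul_assoc]
      _ = _ := by rw [map_smul, smul_eq_mul]
  have e2 : Φ N (x * E (n + 1)) = delta * Φ N (x * E (n + 1) * E n) := by
    calc _ = Φ N ((x * E (n + 1) * E n) * E (n + 1)) := by
          rw [mul_assoc, mul_assoc, ← mul_assoc (E (n + 1)), hE.down]
      _ = Φ N (E (n + 1) * (x * E (n + 1) * E n)) := hΦ.mul_comm (mul_mem (mul_mem hx' h1) h0) h1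
      _ = Φ N (delta • (x * E (n + 1) * E n)) := by
          rw [← mul_assoc, ← mul_assoc, ← c1, mul_assoc x, hE.sq, mul_smul_comm, smul_mul_assoc]
      _ = _ := by rw [map_smul, smul_eq_mul]
  rw [e1, e2, hΦ.mul_comm (mul_mem hx' h1) h0, ← mul_assoc, ← c0]

theorem cap_of_le (hΦ : IsAnnular E Φ) (hE : IsTL E) {n N : ℕ} (h : n ≤ N) {x : B}
    (hx : x ∈ strands E n) : Φ (N + 2) (x * E n) = delta * Φ N x := by
  obtain ⟨k, rfl⟩ := Nat.exists_eq_add_of_le h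
  clear h
  induction k generalizing n with
  | zero => exact hΦ.cap hx
  | succ k ih =>
    rw [hΦ.move_cap hE (by omega) hx, show n + (k + 1) = n + 1 + k by omega]
    exact ih (strands_mono n.le_succ hx)

/-- By cyclicity δ times the closure of f E f is the closure of E f E, a partial closure whose
scalar cancels Wenzl's coefficient up to sign. What remains is the Chebyshev recursion. -/
theorem jonesWenzl_add_two (hΦ : IsAnnular E Φ) (hE : IsTL E) {n N : ℕ} (h : n ≤ N) :
    Φ (N + 2) (jonesWenzl E (n + 2)) =
      Φ (N + 2) (jonesWenzl E (n + 1)) - Φ N (jonesWenzl E n) := by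
  have hd := delta_ne_zero
  have h1 := qInt_ne_zero n.succ_ne_zero
  have h2 := qInt_ne_zero (n + 1).succ_ne_zero
  have hf : jonesWenzl E (n + 1) ∈ strands E (N + 2) :=
    strands_mono (by omega) (jonesWenzl_mem _)
  have he : E n ∈ strands E (N + 2) := mem_strands (by omega)
  have hidem := hE.jonesWenzl_idem (n + 1)
  have key : delta * Φ (N + 2) (jonesWenzl E (n + 1) * E n * jonesWenzl E (n + 1)) =
      -(qInt (n + 2) / qInt (n + 1)) * (delta * Φ N (jonesWenzl E n)) := by
    calc _ = Φ (N + 2) ((jonesWenzl E (n + 1) * E n) * (E n * jonesWenzl E (n + 1))) := by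
          rw [mul_assoc _ (E n) (E n * _), ← mul_assoc (E n) (E n), hE.sq, smul_mul_assoc,
            mul_smul_comm, map_smul, smul_eq_mul, ← mul_assoc]
      _ = Φ (N + 2) ((E n * jonesWenzl E (n + 1)) * (jonesWenzl E (n + 1) * E n)) :=
          hΦ.mul_comm (mul_mem hf he) (mul_mem he hf)
      _ = Φ (N + 2) (E n * jonesWenzl E (n + 1) * E n) := by
          rw [mul_assoc, ← mul_assoc (jonesWenzl E (n + 1)), hidem, ← mul_assoc]
      _ = _ := by
          rw [hE.cap_jonesWenzl_cap, map_smul, smul_eq_mul, hΦ.cap_of_le hE h (jonesWenzl_mem n)]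
  have hdef : jonesWenzl E (n + 2) = jonesWenzl E (n + 1) + (qInt (n + 1) / qInt (n + 2)) •
      (jonesWenzl E (n + 1) * E n * jonesWenzl E (n + 1)) := rfl
  have key' : Φ (N + 2) (jonesWenzl E (n + 1) * E n * jonesWenzl E (n + 1)) =
      -(qInt (n + 2) / qInt (n + 1)) * Φ N (jonesWenzl E n) := by
    apply mul_left_cancel₀ hd
    rw [key]
    ring
  rw [hdef, map_add, map_smul, key', smul_eq_mul]
  field_simp
  ring

end IsAnnular

end Abstract

/-- The Chebyshev basis `e_0 = 1`, `e_1 = z`, `e_{n+2} = z e_{n+1} - e_n` of the skein module. -/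
def cheb : ℕ → Skein
  | 0 => 1
  | 1 => X
  | n + 2 => X * cheb (n + 1) - cheb n

/-! ### Values of the twist and Hopf functionals on Jones–Wenzl idempotents -/

section Abstract

variable {B : Type*} [Ring B] [Algebra K B] {E : ℕ → B} {Φ : ℕ → B →ₗ[K] K}

/-- Both sides satisfy the same recursion; the `k` spare strands absorb its multiplication by z. -/
theorem IsAnnular.apply_cheb (hΦ : IsAnnular E Φ) (hE : IsTL E) (L : Skein →ₗ[Ground] K)
    (hL : ∀ k, L (X ^ k) = Φ k 1) (n k : ℕ) :
    L (X ^ k * cheb n) = Φ (n + k) (jonesWenzl E n) := by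
  induction n using Nat.twoStepInduction generalizing k with
  | zero => rw [cheb, mul_one, hL, zero_add, jonesWenzl]
  | one => rw [cheb, ← pow_succ, hL, jonesWenzl_one, add_comm]
  | more n ih1 ih2 =>
    rw [cheb, mul_sub, ← mul_assoc, ← pow_succ, map_sub, ih1, ih2]
    have := hΦ.jonesWenzl_add_two hE (Nat.le_add_right n k)
    rw [show n + 2 + k = n + k + 2 by omega, this, show n + 1 + (k + 1) = n + k + 2 by omega]

namespace IsMarkov

variable {τ : B →ₗ[K] K}

theorem trace_jonesWenzl (hτ : IsMarkov E τ) (hE : IsTL E) (n : ℕ) :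
    delta ^ n * τ (jonesWenzl E n) = (-1) ^ n * qInt (n + 1) := by
  induction n with
  | zero => simp [jonesWenzl, hτ.one, qInt_one]
  | succ n ih =>
    have h1 := qInt_ne_zero n.succ_ne_zero
    have hd := delta_ne_zero
    have e1 : τ (jonesWenzl E (n + 1)) = τ (E n * jonesWenzl E (n + 1) * E n) := by
      rw [← hτ.markov (jonesWenzl_mem (n + 1)), mul_assoc, hτ.mul_comm (E n), mul_assoc, hE.sq,
        mul_smul_comm, map_smul, smul_eq_mul]
    have e2 : delta * τ (jonesWenzl E (n + 1)) =
        -(qInt (n + 2) / qInt (n + 1)) * τ (jonesWenzl E n) := by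
      rw [e1, hE.cap_jonesWenzl_cap, map_smul, smul_eq_mul, mul_left_comm,
        hτ.markov (strands_mono n.le_succ (jonesWenzl_mem n))]
    rw [pow_succ, mul_assoc, e2, mul_left_comm, ih, pow_succ]
    field_simp

/-- The closure of a framed full twist as a functional on the annulus. -/
def twistFunctional (E : ℕ → B) (τ : B →ₗ[K] K) (n : ℕ) : B →ₗ[K] K :=
  (delta ^ n * (-AK ^ 3) ^ n) • (τ ∘ₗ LinearMap.mulLeft K (twistValue E n))

theorem twistFunctional_apply (n : ℕ) (x : B) : twistFunctional E τ n x =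
    delta ^ n * (-AK ^ 3) ^ n * τ (twistValue E n * x) := rfl

/-- The curls on the two strands that disappear contribute A⁶, which cancels the A⁻⁶ of a twisted
cap. -/
theorem isAnnular_twist (hτ : IsMarkov E τ) (hE : IsTL E) : IsAnnular E (twistFunctional E τ) where
  mul_comm {n x y} hx hy := by
    have h : τ (twistValue E n * (x * y)) = τ (twistValue E n * (y * x)) := by
      rw [← mul_assoc, ← (hE.commute_twistValue_strands hx).eq, mul_assoc, hτ.mul_comm, mul_assoc]
    rw [twistFunctional_apply, twistFunctional_apply, h]
  cap {n x} hx := by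
    have hA := AK_ne_zero
    have h1 : twistValue E n * x ∈ strands E (n + 1) :=
      strands_mono n.le_succ (mul_mem (twistValue_mem n) hx)
    have h2 := (hE.commute_strands hx le_rfl).eq
    have e : delta * τ (twistValue E (n + 2) * (x * E n)) =
        (AK ^ 6)⁻¹ * τ (twistValue E n * x) := by
      rw [h2, ← mul_assoc, hE.twistValue_mul_cap, smul_mul_assoc, map_smul, smul_eq_mul, mul_assoc,
        ← h2, mul_left_comm, ← mul_assoc (twistValue E n), hτ.markov h1]
    rw [twistFunctional_apply, twistFunctional_apply]
    calc _ = delta ^ (n + 1) * (-AK ^ 3) ^ (n + 2) *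
          (delta * τ (twistValue E (n + 2) * (x * E n))) := by ring
      _ = _ := by
          rw [e]
          field_simp
          ring

theorem twistFunctional_jonesWenzl (hτ : IsMarkov E τ) (hE : IsTL E) (n : ℕ) :
    twistFunctional E τ n (jonesWenzl E n) = mu n * ((-1) ^ n * qInt (n + 1)) := by
  -- The exponent of μ_n splits as n² + 2n = 3n + n(n - 1), curls plus full twist.
  have e : (-AK ^ 3) ^ n * AK ^ (n * (n - 1)) = mu n := by
    rw [mu, neg_pow, ← pow_mul, mul_assoc, ← pow_add]
    congr 2
    cases n with
    | zero => rfl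
    | succ n =>
      simp only [Nat.add_sub_cancel]
      ring
  rw [twistFunctional_apply, hE.twistValue_mul_jonesWenzl le_rfl, map_smul, smul_eq_mul,
    ← hτ.trace_jonesWenzl hE, ← e]
  ring

/-- The closure encircled by `m` strands as a functional on the annulus. -/
def hopfFunctional (E : ℕ → B) (τ : B →ₗ[K] K) (m n : ℕ) : B →ₗ[K] K :=
  delta ^ (m + n) • (τ ∘ₗ LinearMap.mulRight K (block E m n * block E n m))

theorem hopfFunctional_apply (m n : ℕ) (x : B) : hopfFunctional E τ m n x =
    delta ^ (m + n) * τ (x * (block E m n * block E n m)) := rfl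

theorem strands_shift_le (m n : ℕ) : strands (fun i => E (m + i)) n ≤ strands E (m + n) := by
  refine Algebra.adjoin_mono ?_
  rintro _ ⟨i, hi, rfl⟩
  exact ⟨m + i, by omega, rfl⟩

/-- Turn-backs of the second block slide through both block crossings, which gives cyclicity; a cap
at its end slips out of the `m` encircling strands. -/
theorem isAnnular_hopf (hτ : IsMarkov E τ) (hE : IsTL E) (m : ℕ) :
    IsAnnular (fun i => E (m + i)) (hopfFunctional E τ m) where
  mul_comm {n x y} hx hy := by
    have hc : Commute y (block E m n * block E n m) :=
      commute_of_mem_strands hy fun i hi =>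
        ((hE.semiconj_block_right m hi).mul_left (hE.semiconj_block_left m hi)).symm
    rw [hopfFunctional_apply, hopfFunctional_apply, mul_assoc, hc.eq, ← mul_assoc, hτ.mul_comm,
      ← mul_assoc]
  cap {n x} hx := by
    have hx' := strands_shift_le m n hx
    have hb : block E m n * block E n m ∈ strands E (m + n) :=
      mul_mem (block_mem m n) (by rw [add_comm m n]; exact block_mem n m)
    have hc := (hE.commute_strands hb le_rfl).eq
    rw [hopfFunctional_apply, hopfFunctional_apply, mul_assoc, hE.cap_block, ← hc, ← mul_assoc,
      ← hτ.markov (strands_mono (m + n).le_succ (mul_mem hx' hb))]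
    ring

/-- Encircling strands are removed one at a time. The idempotent is carried through the crossing of
the remaining strands, so that the last one runs around it alone and costs a factor λ_n. -/
theorem trace_around_jonesWenzl (hτ : IsMarkov E τ) (hE : IsTL E) (n m : ℕ) :
    delta ^ (n + m) * τ (jonesWenzl E n * (block E n m * block E m n)) =
      (-aK ^ (n + 1) - (aK ^ (n + 1))⁻¹) ^ m * ((-1) ^ n * qInt (n + 1)) := by
  induction m with
  | zero =>
    have h := hτ.trace_jonesWenzl hE n
    have h0 : block E n 0 = 1 := by
      clear h
      induction n with
      | zero => rfl
      | succ n ih => rw [block, ih, ascend, mul_one]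
    rw [h0, block, mul_one, mul_one, add_zero, h, pow_zero, one_mul]
  | succ m ih =>
    set f := jonesWenzl (fun i => E (m + i)) n with hf
    have hsemi : SemiconjBy (block E n m) f (jonesWenzl E n) :=
      semiconj_jonesWenzl fun i hi => hE.semiconj_block_left m hi
    have hfm : f ∈ strands E (m + n) := strands_shift_le m n (jonesWenzl_mem n)
    have hcap := (hE.shift m).cap_around_jonesWenzl n
    rw [around_shift, add_zero, ← hf] at hcap
    have hy : block E m n * block E n m ∈ strands E (m + n) :=
      mul_mem (block_mem m n) (by rw [add_comm m n]; exact block_mem n m)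
    have hy' := (hE.commute_strands hy le_rfl).eq
    have hz : block E m n * block E n m * (f * around E m n) ∈ strands E (m + n + 1) :=
      mul_mem (strands_mono (by omega) hy) (mul_mem (strands_mono (by omega) hfm) (around_mem m n))
    have e0 : τ (jonesWenzl E n * (block E n m * block E m n)) =
        τ (block E m n * block E n m * f) := by
      rw [← mul_assoc, ← hsemi.eq, hτ.mul_comm, ← mul_assoc]
    have e1 : jonesWenzl E n * (block E n (m + 1) * block E (m + 1) n) =
        block E n m * (f * around E m n) * block E m n := by
      rw [hE.block_succ_right, block, around]
      simp only [← mul_assoc]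
      rw [hsemi.eq]
    have e2 : τ (block E n m * (f * around E m n) * block E m n) =
        τ (block E m n * block E n m * (f * around E m n)) := by
      rw [hτ.mul_comm, ← mul_assoc, ← mul_assoc]
    have e3 : delta * τ (block E m n * block E n m * (f * around E m n)) =
        (-aK ^ (n + 1) - (aK ^ (n + 1))⁻¹) * τ (block E m n * block E n m * f) := by
      calc _ = delta * τ (E (m + n) * (block E m n * block E n m * (f * around E m n)) *
            E (m + n)) := by
            congr 1
            rw [← hτ.markov hz, mul_assoc (E (m + n)), hτ.mul_comm (E (m + n)),
              mul_assoc _ (E (m + n)), hE.sq, mul_smul_comm, map_smul, smul_eq_mul]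
        _ = delta * τ (block E m n * block E n m *
            (E (m + n) * (f * around E m n) * E (m + n))) := by
            rw [← mul_assoc (E (m + n)), ← hy']
            simp only [mul_assoc]
        _ = _ := by
            rw [hcap, mul_smul_comm, map_smul, smul_eq_mul, ← mul_assoc _ f, mul_left_comm,
              hτ.markov (strands_mono (m + n).le_succ (mul_mem hy hfm))]
    calc _ = delta ^ (n + m) * (delta * τ (block E m n * block E n m * (f * around E m n))) := by
          rw [e1, e2]
          ring
      _ = _ := by
          rw [e3, mul_left_comm, ← e0, ih]
          ring

theorem hopfFunctional_jonesWenzl (hτ : IsMarkov E τ) (hE : IsTL E) (m n : ℕ) :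
    hopfFunctional E τ m n (jonesWenzl (fun i => E (m + i)) n) =
      (-aK ^ (n + 1) - (aK ^ (n + 1))⁻¹) ^ m * ((-1) ^ n * qInt (n + 1)) := by
  have hsemi : SemiconjBy (block E n m) (jonesWenzl (fun i => E (m + i)) n) (jonesWenzl E n) :=
    semiconj_jonesWenzl fun i hi => hE.semiconj_block_left m hi
  rw [← hτ.trace_around_jonesWenzl hE, hopfFunctional_apply, add_comm m n, ← mul_assoc,
    hτ.mul_comm, ← mul_assoc, hsemi.eq, mul_assoc]

end IsMarkov

end Abstract

/-! ### The Hopf pairing and the twist on the Chebyshev basis -/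

theorem fits_blockCross (m n : ℕ) : Fits (m + n) (blockCross m n) := by
  intro i hi
  simp only [blockCross, passRight, List.mem_flatten, List.mem_map, List.mem_reverse,
    List.mem_range, exists_exists_and_eq_and, Piece.cross.injEq] at hi
  obtain ⟨k, hk, j, hj, rfl⟩ := hi
  omega

theorem fits_hopfCable (m n : ℕ) : Fits (m + n) (hopfCable m n) := by
  intro i hi
  rcases List.mem_append.1 hi with h | h
  · exact fits_blockCross m n i h
  · rw [add_comm m n]
    exact fits_blockCross n m i h

theorem fits_twistedCable (n : ℕ) : Fits n (twistedCable n) := by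
  have h : Fits n (fullTwist n) := by
    induction n with
    | zero =>
      intro i hi
      simp [fullTwist] at hi
    | succ n ih =>
      intro i hi
      rcases List.mem_append.1 hi with h | h
      · exact (ih i h).trans n.lt_succ_self
      · simp only [runAround, List.mem_append, List.mem_map, List.mem_reverse, List.mem_range,
          Piece.cross.injEq, exists_eq_right, or_self] at h
        omega
  intro i hi
  rcases List.mem_append.1 hi with h' | h'
  · exact h i h'
  · simp at h'

theorem algebraMap_bracket_hopfCable (m n : ℕ) :
    algebraMap Ground K (bracket (m + n) (hopfCable m n)) =
      IsMarkov.hopfFunctional turnBack markovTrace m n 1 := by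
  rw [algebraMap_bracket (fits_hopfCable m n), hopfCable, braidValue_append,
    braidValue_blockCross, braidValue_blockCross, IsMarkov.hopfFunctional_apply, one_mul]

theorem algebraMap_bracket_twistedCable (n : ℕ) :
    algebraMap Ground K (bracket n (twistedCable n)) =
      IsMarkov.twistFunctional turnBack markovTrace n 1 := by
  rw [algebraMap_bracket (fits_twistedCable n), braidValue_twistedCable, map_smul,
    IsMarkov.twistFunctional_apply, mul_one, smul_eq_mul, mul_assoc]

/-- The linear functional on the skein module with given values on the powers of `z`. -/
def functional (b : ℕ → Ground) : Skein →ₗ[Ground] K :=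
  Polynomial.lsum fun n => LinearMap.toSpanSingleton Ground K (algebraMap Ground K (b n))

theorem functional_apply (b : ℕ → Ground) (x : Skein) :
    functional b x = algebraMap Ground K (x.sum fun n d => d * b n) := by
  simp [functional, Polynomial.sum, Algebra.smul_def]

theorem functional_X_pow (b : ℕ → Ground) (k : ℕ) :
    functional b (X ^ k) = algebraMap Ground K (b k) := by
  rw [functional_apply, ← monomial_one_right_eq_X_pow, sum_monomial_index _ _ (by simp), one_mul]

theorem algebraMap_lam (n : ℕ) :
    algebraMap Ground K (lam n) = -aK ^ (n + 1) - (aK ^ (n + 1))⁻¹ := by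
  have h1 := algebraMap_A_natCast (2 * (n + 1))
  have h2 := algebraMap_A_neg (2 * (n + 1))
  rw [aK, ← pow_mul, ← h2, ← h1, lam, a, a, map_sub, map_neg]
  push_cast
  ring_nf

theorem pairing_eq (x y : Skein) : algebraMap Ground K (pairing x y) =
    x.sum fun m c => algebraMap Ground K c *
      functional (fun n => bracket (m + n) (hopfCable m n)) y := by
  simp only [pairing, functional_apply, Polynomial.sum, ← map_mul, ← map_sum, Finset.mul_sum,
    mul_assoc]

/-- Encircling by `z` acts on `e_n` by `λ_n`. -/
theorem pairing_cheb (x : Skein) (n : ℕ) : algebraMap Ground K (pairing x (cheb n)) =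
    (x.map (algebraMap Ground K)).eval (algebraMap Ground K (lam n)) *
      ((-1) ^ n * qInt (n + 1)) := by
  have h : ∀ m, functional (fun n => bracket (m + n) (hopfCable m n)) (cheb n) =
      algebraMap Ground K (lam n) ^ m * ((-1) ^ n * qInt (n + 1)) := by
    intro m
    have h1 := (isMarkov_markovTrace.isAnnular_hopf isTL_turnBack m).apply_cheb
      (isTL_turnBack.shift m) (functional fun n => bracket (m + n) (hopfCable m n))
      (fun k => by rw [functional_X_pow, algebraMap_bracket_hopfCable]) n 0
    rw [pow_zero, one_mul, add_zero,
      isMarkov_markovTrace.hopfFunctional_jonesWenzl isTL_turnBack] at h1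
    rw [h1, algebraMap_lam]
  rw [pairing_eq, eval_map, eval₂_eq_sum, Polynomial.sum, Polynomial.sum, Finset.sum_mul]
  refine Finset.sum_congr rfl fun m _ => ?_
  rw [h, mul_assoc]

theorem value_eq (x : Skein) : value x = x.eval circleValue := by
  have h : ∀ m, bracket (m + 0) (hopfCable m 0) = circleValue ^ m := by
    intro m
    have h0 : hopfCable m 0 = [] := by
      simp [hopfCable, blockCross, passRight]
    rw [h0, bracket, annularClass, resolve, eval_flatClass, circleCount_nil, add_zero]
  rw [value, pairing, eval_eq_sum]
  refine Finset.sum_congr rfl fun m _ => ?_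
  simp only
  rw [← C_1, sum_C_index (by simp), mul_one, h]

theorem value_twist_eq (x : Skein) : algebraMap Ground K (value (twist x)) =
    functional (fun n => bracket n (twistedCable n)) x := by
  rw [value_eq, functional_apply, twist, Polynomial.sum, Polynomial.sum, eval_finsetSum]
  simp only [eval_smul, smul_eq_mul, bracket]

/-- The twist acts on `e_n` by `μ_n`. -/
theorem value_twist_cheb (n : ℕ) :
    algebraMap Ground K (value (twist (cheb n))) = mu n * ((-1) ^ n * qInt (n + 1)) := by
  have h := (isMarkov_markovTrace.isAnnular_twist isTL_turnBack).apply_cheb isTL_turnBack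
    (functional fun n => bracket n (twistedCable n))
    (fun k => by rw [functional_X_pow, algebraMap_bracket_twistedCable]) n 0
  rw [pow_zero, one_mul, add_zero,
    isMarkov_markovTrace.twistFunctional_jonesWenzl isTL_turnBack] at h
  rw [value_twist_eq, h]

/-! ### Even polynomials -/

theorem X_sq_mul_mem_evenPart {x : Skein} (hx : x ∈ evenPart) : X ^ 2 * x ∈ evenPart := by
  refine Submodule.span_induction ?_ (by simp) ?_ ?_ hx
  · rintro _ ⟨k, rfl⟩
    refine Submodule.subset_span ⟨k + 1, ?_⟩
    simp only
    ring
  · intro x y _ _ hx hy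
    rw [mul_add]
    exact add_mem hx hy
  · intro c x _ hx
    rw [mul_smul_comm]
    exact Submodule.smul_mem _ _ hx

theorem cheb_even_add_two (k : ℕ) :
    cheb (2 * (k + 2)) = X ^ 2 * cheb (2 * (k + 1)) - 2 * cheb (2 * (k + 1)) - cheb (2 * k) := by
  have h1 : cheb (2 * k + 4) = X * cheb (2 * k + 3) - cheb (2 * k + 2) := rfl
  have h2 : cheb (2 * k + 3) = X * cheb (2 * k + 2) - cheb (2 * k + 1) := rfl
  have h3 : cheb (2 * k + 2) = X * cheb (2 * k + 1) - cheb (2 * k) := rfl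
  rw [show 2 * (k + 2) = 2 * k + 4 by ring, show 2 * (k + 1) = 2 * k + 2 by ring, h1, h2]
  linear_combination h3

theorem cheb_even_mem (k : ℕ) : cheb (2 * k) ∈ evenPart := by
  induction k using Nat.twoStepInduction with
  | zero => exact Submodule.subset_span ⟨0, by simp [cheb]⟩
  | one =>
    have h0 : (1 : Skein) ∈ evenPart := Submodule.subset_span ⟨0, by simp⟩
    have h1 : (X : Skein) ^ 2 ∈ evenPart := Submodule.subset_span ⟨1, by simp⟩
    have : cheb (2 * 1) = X ^ 2 - 1 := by
      rw [mul_one, cheb, cheb, cheb]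
      ring
    rw [this]
    exact sub_mem h1 h0
  | more k ih1 ih2 =>
    rw [cheb_even_add_two, two_mul (cheb _)]
    exact sub_mem (sub_mem (X_sq_mul_mem_evenPart ih2) (add_mem ih2 ih2)) ih1

theorem evenPart_le_span_cheb :
    evenPart ≤ Submodule.span Ground (Set.range fun k : ℕ => cheb (2 * k)) := by
  set S := Submodule.span Ground (Set.range fun k : ℕ => cheb (2 * k)) with hS
  have hmem : ∀ k, cheb (2 * k) ∈ S := fun k => Submodule.subset_span ⟨k, rfl⟩
  have hX : ∀ x ∈ S, X ^ 2 * x ∈ S := by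
    intro x hx
    refine Submodule.span_induction ?_ (by simp) ?_ ?_ hx
    · rintro _ ⟨k, rfl⟩
      simp only
      cases k with
      | zero =>
        have : X ^ 2 * cheb (2 * 0) = cheb (2 * 1) + cheb (2 * 0) := by
          rw [show cheb (2 * 1) = X * X - 1 from rfl, show cheb (2 * 0) = 1 from rfl]
          ring
        rw [this]
        exact add_mem (hmem 1) (hmem 0)
      | succ k =>
        have : X ^ 2 * cheb (2 * (k + 1)) =
            cheb (2 * (k + 2)) + (cheb (2 * (k + 1)) + cheb (2 * (k + 1))) + cheb (2 * k) := by
          rw [cheb_even_add_two]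
          ring
        rw [this]
        exact add_mem (add_mem (hmem _) (add_mem (hmem _) (hmem _))) (hmem _)
    · intro x y _ _ hx hy
      rw [mul_add]
      exact add_mem hx hy
    · intro c x _ hx
      rw [mul_smul_comm]
      exact Submodule.smul_mem _ _ hx
  refine Submodule.span_le.2 ?_
  rintro _ ⟨k, rfl⟩
  change (X : Skein) ^ (2 * k) ∈ S
  induction k with
  | zero => exact hmem 0
  | succ k ih =>
    rw [mul_add, mul_one, pow_add, mul_comm]
    exact hX _ ih

/-! ### Newton interpolation at the points `λ_{2k}` -/

/-- The points `λ_{2k}` in `ℚ(A)`. -/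
def node (k : ℕ) : K := algebraMap Ground K (lam (2 * k))

/-- The formula for a difference of two cosines: k - i and k + i + 1 are the half difference and
half sum of 2k + 1 and 2i + 1. -/
theorem node_sub_node (k i : ℕ) (h : i ≤ k) :
    node k - node i = -((aK - aK⁻¹) ^ 2 * (qInt (k - i) * qInt (k + i + 1))) := by
  obtain ⟨j, rfl⟩ := Nat.exists_eq_add_of_le h
  have h0 := aK_ne_zero
  have h1 := aK_sub_inv_ne_zero
  rw [node, node, algebraMap_lam, algebraMap_lam, Nat.add_sub_cancel_left]
  have e : (aK - aK⁻¹) ^ 2 * (qInt j * qInt (i + j + i + 1)) =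
      (aK ^ j - (aK ^ j)⁻¹) * (aK ^ (i + j + i + 1) - (aK ^ (i + j + i + 1))⁻¹) := by
    rw [qInt, qInt]
    generalize aK - aK⁻¹ = y at h1
    field_simp
  rw [e]
  field_simp
  ring

theorem node_injective : Function.Injective node := by
  have key : ∀ k i, i < k → node k ≠ node i := by
    intro k i h
    rw [← sub_ne_zero, node_sub_node k i h.le]
    exact neg_ne_zero.2 (mul_ne_zero (pow_ne_zero _ aK_sub_inv_ne_zero)
      (mul_ne_zero (qInt_ne_zero (by omega)) (qInt_ne_zero (by omega))))
  intro k i h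
  rcases lt_trichotomy k i with h' | h' | h'
  · exact absurd h.symm (key _ _ h')
  · exact h'
  · exact absurd h (key _ _ h')

theorem RK_eq_nodal (n : ℕ) : RK n = Lagrange.nodal (Finset.range n) node := by
  simp [RK, R, Lagrange.nodal, Polynomial.map_prod, node]

theorem eval_RK (n k : ℕ) : (RK n).eval (node k) = ∏ i ∈ Finset.range n, (node k - node i) := by
  rw [RK_eq_nodal, Lagrange.eval_nodal]

theorem eval_RK_of_lt {n k : ℕ} (h : k < n) : (RK n).eval (node k) = 0 := by
  rw [RK_eq_nodal, Lagrange.eval_nodal_at_node (Finset.mem_range.2 h)]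

theorem eval_RK_self_ne_zero (n : ℕ) : (RK n).eval (node n) ≠ 0 := by
  rw [eval_RK, Finset.prod_ne_zero_iff]
  intro i hi
  rw [sub_ne_zero]
  exact node_injective.ne (Finset.mem_range.1 hi).ne'

/-- The linear factors are pairwise coprime because the nodes are distinct. Equality in each
quotient thereby becomes equality of values. -/
theorem RK_dvd_iff {n : ℕ} {p : K[X]} : RK n ∣ p ↔ ∀ k < n, p.eval (node k) = 0 := by
  constructor
  · rintro ⟨q, rfl⟩ k hk
    rw [eval_mul, eval_RK_of_lt hk, zero_mul]
  · intro h
    rw [RK_eq_nodal, Lagrange.nodal]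
    refine Finset.prod_dvd_of_coprime ?_ fun i hi => ?_
    · intro i _ j _ hij
      exact isCoprime_X_sub_C_of_isUnit_sub (sub_ne_zero.2 (node_injective.ne hij)).isUnit
    · rw [dvd_iff_isRoot]
      exact h i (Finset.mem_range.1 hi)

theorem mk_eq_mk_iff {n : ℕ} {p q : K[X]} :
    Ideal.Quotient.mk (Ideal.span {RK n}) p = Ideal.Quotient.mk (Ideal.span {RK n}) q ↔
      ∀ k < n, p.eval (node k) = q.eval (node k) := by
  rw [Ideal.Quotient.eq, Ideal.mem_span_singleton, RK_dvd_iff]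
  simp only [eval_sub, sub_eq_zero]

/-- The interpolation polynomial at the first `N` points. -/
def interp (y : ℕ → K) (N : ℕ) : K[X] := Lagrange.interpolate (Finset.range N) node y

theorem eval_interp (y : ℕ → K) {N k : ℕ} (h : k < N) : (interp y N).eval (node k) = y k :=
  Lagrange.eval_interpolate_at_node y node_injective.injOn (Finset.mem_range.2 h)

/-- The element of the completed algebra with given values at the points `λ_{2k}`. -/
def ofValues : (ℕ → K) →* Completed where
  toFun y := ⟨fun N => Ideal.Quotient.mk _ (interp y N), fun n => by
    rw [Ideal.Quotient.factor_mk, mk_eq_mk_iff]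
    intro k hk
    rw [eval_interp y (by omega), eval_interp y hk]⟩
  map_one' := by
    refine Subtype.ext (funext fun N => ?_)
    change Ideal.Quotient.mk _ _ = Ideal.Quotient.mk _ 1
    rw [mk_eq_mk_iff]
    intro k hk
    rw [eval_interp _ hk, eval_one, Pi.one_apply]
  map_mul' y z := by
    refine Subtype.ext (funext fun N => ?_)
    change Ideal.Quotient.mk _ _ = Ideal.Quotient.mk _ (interp y N * interp z N)
    rw [mk_eq_mk_iff]
    intro k hk
    rw [eval_mul, eval_interp _ hk, eval_interp _ hk, eval_interp _ hk, Pi.mul_apply]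

theorem ofValues_apply (y : ℕ → K) (N : ℕ) :
    (ofValues y : ∀ n : ℕ, K[X] ⧸ Ideal.span {RK n}) N = Ideal.Quotient.mk _ (interp y N) := rfl

/-- The partial sums of `∑ c_n R_n` take the values `y`. -/
def Interpolates (c y : ℕ → K) : Prop :=
  ∀ N, ∀ k < N, ∑ n ∈ Finset.range N, c n * (RK n).eval (node k) = y k

theorem eval_partialSum (c : ℕ → K) (N k : ℕ) :
    (∑ n ∈ Finset.range N, C (c n) * RK n).eval (node k) =
      ∑ n ∈ Finset.range N, c n * (RK n).eval (node k) := by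
  simp [eval_finsetSum]

theorem hasExpansion_ofValues_iff (y c : ℕ → K) :
    HasExpansion (ofValues y) c ↔ Interpolates c y := by
  refine forall_congr' fun N => ?_
  rw [ofValues_apply, mk_eq_mk_iff]
  refine forall₂_congr fun k hk => ?_
  rw [eval_interp y hk, eval_partialSum, eq_comm]

theorem eq_ofValues {f : Completed} {c y : ℕ → K} (hf : HasExpansion f c)
    (h : Interpolates c y) : f = ofValues y := by
  refine Subtype.ext (funext fun N => ?_)
  rw [hf N, ((hasExpansion_ofValues_iff y c).2 h) N]

theorem sum_RK_eq {c : ℕ → K} {N k : ℕ} (h : k < N) :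
    ∑ n ∈ Finset.range N, c n * (RK n).eval (node k) =
      ∑ n ∈ Finset.range (k + 1), c n * (RK n).eval (node k) := by
  symm
  refine Finset.sum_subset (Finset.range_mono h) fun n _ hn => ?_
  rw [eval_RK_of_lt (by simpa using hn), mul_zero]

/-- The system is triangular: once the earlier coefficients agree, evaluation at node `n` isolates
`c n` with the nonzero factor R_n(λ_{2n}). -/
theorem Interpolates.unique {c c' y : ℕ → K} (h : Interpolates c y) (h' : Interpolates c' y) :
    c = c' := by
  funext n
  induction n using Nat.strong_induction_on with
  | _ n ih =>
    have h1 := (h (n + 1) n n.lt_succ_self).trans (h' (n + 1) n n.lt_succ_self).symm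
    rw [Finset.sum_range_succ, Finset.sum_range_succ,
      Finset.sum_congr rfl fun i hi => by rw [ih i (Finset.mem_range.1 hi)]] at h1
    exact mul_right_cancel₀ (eval_RK_self_ne_zero n) (add_left_cancel h1)

/-- Newton's divided differences. -/
def newton (y : ℕ → K) (n : ℕ) : K :=
  ∑ k ∈ Finset.range (n + 1), y k / ∏ i ∈ (Finset.range (n + 1)).erase k, (node k - node i)

/-- The two candidates for the interpolant at `N + 1` nodes agree at the first `N` nodes and in the
coefficient of degree `N`, which Lagrange's formula identifies as the divided difference. Their
difference has degree below `N` and `N` roots. -/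
theorem interp_eq_sum (y : ℕ → K) (N : ℕ) :
    interp y N = ∑ n ∈ Finset.range N, C (newton y n) * RK n := by
  induction N with
  | zero => simp [interp]
  | succ N ih =>
    rw [Finset.sum_range_succ, ← ih]
    have hdeg : ∀ M, (interp y M).degree < M := fun M => by
      have := Lagrange.degree_interpolate_lt (s := Finset.range M) y node_injective.injOn
      rwa [Finset.card_range] at this
    have hRdeg : (RK N).degree = N := by rw [RK_eq_nodal, Lagrange.degree_nodal]; simp
    have hRcoeff : (RK N).coeff N = 1 := by
      have h : (RK N).Monic := by rw [RK_eq_nodal]; exact Lagrange.nodal_monic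
      rwa [Monic, leadingCoeff, natDegree_eq_of_degree_eq_some hRdeg] at h
    have hcoeff : (interp y (N + 1)).coeff N = newton y N := by
      have := Lagrange.coeff_eq_sum (s := Finset.range (N + 1)) (v := node)
        node_injective.injOn (P := interp y (N + 1)) (by rw [Finset.card_range]; exact hdeg _)
      rw [Finset.card_range, Nat.add_sub_cancel] at this
      rw [this, newton]
      refine Finset.sum_congr rfl fun k hk => ?_
      rw [eval_interp y (Finset.mem_range.1 hk)]
    refine eq_of_sub_eq_zero (Polynomial.eq_zero_of_degree_lt_of_eval_index_eq_zero
      (s := Finset.range N) (v := node) node_injective.injOn ?_ fun k hk => ?_)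
    · rw [Finset.card_range, degree_lt_iff_coeff_zero]
      intro m hm
      rw [coeff_sub, coeff_add, coeff_C_mul,
        coeff_eq_zero_of_degree_lt ((hdeg N).trans_le (WithBot.coe_le_coe.2 hm)), zero_add]
      rcases hm.eq_or_lt with rfl | hm'
      · rw [hcoeff, hRcoeff, mul_one, sub_self]
      · rw [coeff_eq_zero_of_degree_lt ((hdeg (N + 1)).trans_le (WithBot.coe_le_coe.2 hm')),
          coeff_eq_zero_of_degree_lt (hRdeg.trans_lt (WithBot.coe_lt_coe.2 hm')), mul_zero,
          sub_self]
    · have hk' := Finset.mem_range.1 hk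
      rw [eval_sub, eval_add, eval_mul, eval_RK_of_lt hk', eval_interp y hk',
        eval_interp y (hk'.trans N.lt_succ_self), mul_zero, add_zero, sub_self]

theorem interpolates_newton (y : ℕ → K) : Interpolates (newton y) y := by
  intro N k hk
  rw [← eval_partialSum, ← interp_eq_sum, eval_interp y hk]

theorem hasExpansion_ofValues_iff_newton (y c : ℕ → K) :
    HasExpansion (ofValues y) c ↔ c = newton y := by
  rw [hasExpansion_ofValues_iff]
  constructor
  · exact fun h => h.unique (interpolates_newton y)
  · rintro rfl
    exact interpolates_newton y

/-! ### Divided differences in terms of quantum factorials -/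

theorem qFactorial_succ (n : ℕ) : qFactorial (n + 1) = qFactorial n * qInt (n + 1) :=
  Finset.prod_range_succ _ _

theorem qFactorial_ne_zero (n : ℕ) : qFactorial n ≠ 0 :=
  Finset.prod_ne_zero_iff.2 fun _ _ => qInt_ne_zero (Nat.succ_ne_zero _)

theorem qFactorial_add (m n : ℕ) :
    qFactorial (m + n) = qFactorial m * ∏ i ∈ Finset.range n, qInt (m + i + 1) :=
  Finset.prod_range_add _ _ _

theorem qFactorial_eq_prod_sub (n : ℕ) : ∏ i ∈ Finset.range n, qInt (n - i) = qFactorial n := by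
  rw [qFactorial, ← Finset.prod_range_reflect]
  refine Finset.prod_congr rfl fun i hi => ?_
  have := Finset.mem_range.1 hi
  congr 1
  omega

/-- The factor [2k+1] is the one that omitting i = k leaves out of [n+k+1]!. Each node below `k`
contributes a sign, while for nodes above `k` the reversed difference is positive in the sense of
`node_sub_node`. -/
theorem prod_node_sub {n k : ℕ} (h : k ≤ n) :
    (∏ i ∈ (Finset.range (n + 1)).erase k, (node k - node i)) * qInt (2 * k + 1) =
      (-1) ^ k * (aK - aK⁻¹) ^ (2 * n) * (qFactorial (n + k + 1) * qFactorial (n - k)) := by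
  induction n, h using Nat.le_induction with
  | base =>
    rw [Finset.range_add_one, Finset.erase_insert Finset.notMem_range_self,
      Finset.prod_congr rfl fun i hi => node_sub_node k i (Finset.mem_range.1 hi).le]
    have e : ∀ i, -((aK - aK⁻¹) ^ 2 * (qInt (k - i) * qInt (k + i + 1))) =
        (-1 * (aK - aK⁻¹) ^ 2) * (qInt (k - i) * qInt (k + i + 1)) := fun i => by ring
    simp only [e]
    rw [Finset.prod_mul_distrib, Finset.prod_const, Finset.prod_mul_distrib, Finset.card_range,
      qFactorial_eq_prod_sub, ← qFactorial_add, mul_pow, ← pow_mul, Nat.sub_self,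
      qFactorial_succ, two_mul k, show qFactorial 0 = 1 from rfl]
    ring
  | succ n hn ih =>
    have hne : n + 1 ≠ k := by omega
    rw [Finset.range_add_one, Finset.erase_insert_of_ne hne, Finset.prod_insert (by simp),
      mul_assoc, ih, ← neg_sub, node_sub_node (n + 1) k (by omega),
      show n + 1 - k = n - k + 1 by omega, show n + 1 + k + 1 = n + k + 1 + 1 by omega,
      qFactorial_succ (n - k), qFactorial_succ (n + k + 1)]
    ring

theorem newton_eq (y : ℕ → K) (n : ℕ) : newton y n = 1 / (aK - aK⁻¹) ^ (2 * n) *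
    ∑ k ∈ Finset.range (n + 1), (-1) ^ k * y k * qInt (2 * k + 1) /
      (qFactorial (n + k + 1) * qFactorial (n - k)) := by
  rw [newton, Finset.mul_sum]
  refine Finset.sum_congr rfl fun k hk => ?_
  have hk' : k ≤ n := Nat.lt_succ_iff.1 (Finset.mem_range.1 hk)
  have h := prod_node_sub hk'
  have h1 := aK_sub_inv_ne_zero
  have h2 := qFactorial_ne_zero (n + k + 1)
  have h3 := qFactorial_ne_zero (n - k)
  have h4 : qInt (2 * k + 1) ≠ 0 := qInt_ne_zero (Nat.succ_ne_zero _)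
  have h5 : ((-1 : K) ^ k) * (-1) ^ k = 1 := by rw [← mul_pow]; simp
  have h6 : ∏ i ∈ (Finset.range (n + 1)).erase k, (node k - node i) =
      (-1) ^ k * (aK - aK⁻¹) ^ (2 * n) * (qFactorial (n + k + 1) * qFactorial (n - k)) /
        qInt (2 * k + 1) := by
    rw [eq_div_iff h4, h]
  have h7 : ((-1 : K) ^ k) ≠ 0 := pow_ne_zero _ (by simp)
  rw [h6]
  generalize aK - aK⁻¹ = z at h1
  rw [div_div_eq_mul_div, one_div_mul_eq_div, div_div, div_eq_div_iff
    (mul_ne_zero (mul_ne_zero h7 (pow_ne_zero _ h1)) (mul_ne_zero h2 h3))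
    (mul_ne_zero (mul_ne_zero h2 h3) (pow_ne_zero _ h1))]
  linear_combination (-(y k * qInt (2 * k + 1) * z ^ (2 * n) *
    (qFactorial (n + k + 1) * qFactorial (n - k)))) * h5

/-! ### The twist element -/

/-- The values `μ_{2k}` of `ω` at the points `λ_{2k}`. -/
def twistUnit : (ℕ → K)ˣ where
  val k := mu (2 * k)
  inv k := (mu (2 * k))⁻¹
  val_inv := funext fun k => mul_inv_cancel₀ (mul_ne_zero (pow_ne_zero _ (by simp))
    (pow_ne_zero _ AK_ne_zero))
  inv_val := funext fun k => inv_mul_cancel₀ (mul_ne_zero (pow_ne_zero _ (by simp))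
    (pow_ne_zero _ AK_ne_zero))

theorem twistUnit_zpow (p : ℤ) : ((twistUnit ^ p : (ℕ → K)ˣ) : ℕ → K) =
    fun k => mu (2 * k) ^ p := by
  rw [Units.val_zpow_eq_zpow_val]
  rfl

theorem pairing_R_cheb (n k : ℕ) : algebraMap Ground K (pairing (R n) (cheb (2 * k))) =
    (RK n).eval (node k) * qInt (2 * k + 1) := by
  rw [pairing_cheb, Even.neg_one_pow (even_two_mul k), one_mul]
  rfl

theorem pairing_add_right (x y z : Skein) : algebraMap Ground K (pairing x (y + z)) =
    algebraMap Ground K (pairing x y) + algebraMap Ground K (pairing x z) := by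
  simp only [pairing_eq, Polynomial.sum, map_add, mul_add, Finset.sum_add_distrib]

theorem pairing_smul_right (x y : Skein) (c : Ground) : algebraMap Ground K (pairing x (c • y)) =
    algebraMap Ground K c * algebraMap Ground K (pairing x y) := by
  simp only [pairing_eq, Polynomial.sum, map_smul, Finset.mul_sum]
  refine Finset.sum_congr rfl fun m _ => ?_
  rw [Algebra.smul_def, mul_left_comm]

/-- On e_{2k} both sides carry the nonzero factor [2k+1]; cancelling it leaves the condition on the
value at node `k`, where partial sums are constant once `N > k`. The converse extends from the
e_{2k} by linearity. -/
theorem inducesTwist_iff (f : Completed) :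
    InducesTwist f ↔ f = ofValues fun k => mu (2 * k) := by
  constructor
  · rintro ⟨c, hc, h⟩
    refine eq_ofValues hc fun N k hk => ?_
    obtain ⟨M, hM, hkM⟩ :=
      ((h _ (cheb_even_mem k)).and (Filter.eventually_ge_atTop (k + 1))).exists
    simp only [pairing_R_cheb, value_twist_cheb, Even.neg_one_pow (even_two_mul k), one_mul,
      ← mul_assoc, ← Finset.sum_mul] at hM
    rw [sum_RK_eq hk, ← sum_RK_eq hkM]
    exact mul_right_cancel₀ (qInt_ne_zero (Nat.succ_ne_zero _)) hM
  · rintro rfl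
    refine ⟨newton _, (hasExpansion_ofValues_iff_newton _ _).2 rfl, fun x hx => ?_⟩
    refine Submodule.span_induction ?_ ?_ ?_ ?_ (evenPart_le_span_cheb hx)
    · rintro _ ⟨k, rfl⟩
      filter_upwards [Filter.eventually_ge_atTop (k + 1)] with N hN
      simp only [pairing_R_cheb, value_twist_cheb, Even.neg_one_pow (even_two_mul k), one_mul,
        ← mul_assoc, ← Finset.sum_mul]
      rw [interpolates_newton _ N k hN]
    · refine Filter.Eventually.of_forall fun N => ?_
      simp [pairing_eq, value_twist_eq, Polynomial.sum]
    · intro x y _ _ hx hy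
      filter_upwards [hx, hy] with N hx hy
      rw [value_twist_eq] at hx hy ⊢
      rw [map_add, ← hx, ← hy, ← Finset.sum_add_distrib]
      exact Finset.sum_congr rfl fun n _ => by rw [pairing_add_right, mul_add]
    · intro r x _ hx
      filter_upwards [hx] with N hx
      rw [value_twist_eq] at hx ⊢
      rw [map_smul, ← hx, Algebra.smul_def (A := K), Finset.mul_sum]
      exact Finset.sum_congr rfl fun n _ => by rw [pairing_smul_right, mul_left_comm]

end

end KauffmanSkein

open KauffmanSkein in
/-- There is exactly one `ω` with `⟨ω, x⟩ = ⟨t(x)⟩` for all even `x`; it is invertible, and for all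
`p ∈ ℤ` the coefficients of `ω ^ p = ∑ c_{n,p} R_n` are unique and given by the formula. -/
theorem mainTheorem2 :
    ∃ ω : Completedˣ, (∀ f : Completed, InducesTwist f ↔ f = ω) ∧
      ∀ (p : ℤ) (c : ℕ → K), HasExpansion ((ω ^ p : Completedˣ) : Completed) c ↔
        ∀ n : ℕ, c n = 1 / (aK - aK⁻¹) ^ (2 * n) *
          ∑ k ∈ Finset.range (n + 1),
            (-1) ^ k * mu (2 * k) ^ p * qInt (2 * k + 1) /
              (qFactorial (n + k + 1) * qFactorial (n - k)) := by
  -- Multiplicativity of `ofValues` transports both the inverse and the integer powers from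
  -- pointwise operations on values.
  refine ⟨Units.map ofValues twistUnit, inducesTwist_iff, fun p c => ?_⟩
  rw [← map_zpow, Units.coe_map, twistUnit_zpow,
    hasExpansion_ofValues_iff_newton, funext_iff]
  simp only [newton_eq]
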